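/- Let $p$ be a prime, $q=p^e$, and let $A=\mathbb{Z}_{n_1}\times\cdots\times\mathbb{Z}_{n_h}$ (with all $n_\ell\ge 1$) have exponent $N$ with $(N,q)=1$. Let $m=\mathrm{ord}_N(q)$ be the multiplicative order of $q$ modulo $N$, and for each $\ell$ let $\gamma_\ell\in\mathbb{F}_{q^m}$ be a primitive $n_\ell$-th root of unity. Let $C$ be an abelian code, i.e. an ideal of the group algebra $\mathbb{F}_q[A]$. The Hamming weight of an element of $\mathbb{F}_q[A]$ is the number of its nonzero coefficients, and for $a\in\mathbb{N}$ let $S_p(a)$ be the sum of the base-$p$ digits of $a$. (i) There are $k\ge 0$ and pairwise distinct $s_i=(s_{i,1},\dots,s_{i,h})\in A$, $1\le i\le k$, such that $C$ is the set of all words $$c(\boldsymbol\alpha)=\Bigl(\mathrm{Tr}_{q^m/q}\Bigl(\sum_{i=1}^k\alpha_i\prod_{\ell=1}^h\gamma_\ell^{s_{i,\ell}j_\ell}\Bigr)\Bigr)_{(j_1,\dots,j_h)\in A},\qquad \boldsymbol\alpha\in\mathbb{F}_{q^m}^k. \tag{$*$}$$ (ii) Suppose $C\ne\{0\}$, and let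 $s_1,\dots,s_k\in A$ be any elements for which $(*)$ describes $C$. Then the $p$-adic valuation of $C$, i.e. the greatest integer $t$ such that $p^t$ divides the Hamming weight of every codeword of $C$, exists and equals $$\min_{\boldsymbol r}\ \frac{1}{p-1}\sum_{i=1}^k S_p(r_i)-e,$$ where the minimum is over all $\boldsymbol r=(r_1,\dots,r_k)\in[0,q^m-1]^k$ with $\boldsymbol r\neq\boldsymbol 0$, $\sum_{i=1}^k r_i\equiv 0\pmod{q-1}$, and $\sum_{i=1}^k r_i s_{i,\ell}\equiv 0\pmod{n_\ell}$ for all $1\le\ell\le h$. -/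

import Mathlib

namespace AbelianCode

/-- The group `ℤ/n₁ × ⋯ × ℤ/n_h`. -/
abbrev Grp {h : ℕ} (n : Fin h → ℕ) : Type := (ℓ : Fin h) → ZMod (n ℓ)

/-- `S_p(a)`: the sum of the base-`p` digits of `a`. -/
def digitSum (p a : ℕ) : ℕ := (Nat.digits p a).sum

/-- The Hamming weight of an element of the group algebra: the number of its nonzero
coefficients. -/
def weight {F A : Type*} [Semiring F] (c : AddMonoidAlgebra F A) : ℕ := c.coeff.support.card

/-- All the Hamming weights of `C` are divisible by `Δ`. -/
def IsDivisible {F A : Type*} [Semiring F] (Δ : ℕ) (C : Set (AddMonoidAlgebra F A)) : Prop :=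
  ∀ c ∈ C, Δ ∣ weight c

/-- `t` is the `p`-adic valuation of the code `C`: the greatest integer such that `C` is
`p ^ t`-divisible. -/
def IsPadicValuation {F A : Type*} [Semiring F] (p : ℕ) (C : Set (AddMonoidAlgebra F A))
    (t : ℕ) : Prop :=
  IsGreatest {u : ℕ | IsDivisible (p ^ u) C} t

/-- `C` is the set of all words `(Tr_{K/F} (∑ i, α i * G i j))_j`, where `α` runs through `K^k`. -/
def IsTraceCodeOf {F K A : Type*} [Field F] [Field K] [Algebra F K] {k : ℕ}
    (C : Set (AddMonoidAlgebra F A)) (G : Matrix (Fin k) A K) : Prop :=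
  ∀ c : AddMonoidAlgebra F A,
    c ∈ C ↔ ∃ α : Fin k → K, ∀ j : A, c.coeff j = Algebra.trace F K (∑ i, α i * G i j)

/-- The matrix `(∏ ℓ, γ_ℓ ^ (s_{i,ℓ} j_ℓ))` with rows `i` and columns `j ∈ ℤ/n₁ × ⋯ × ℤ/n_h`. -/
def expMatrix {K : Type*} [Field K] {h k : ℕ} {n : Fin h → ℕ} (γ : Fin h → K)
    (s : Fin k → Grp n) : Matrix (Fin k) (Grp n) K :=
  fun i j => ∏ ℓ, γ ℓ ^ ((s i ℓ).val * (j ℓ).val)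

/-- The feasible set of the minimization problem: nonzero `r ∈ [0, Q - 1]^k` (with `Q = q ^ m`)
such that `|r| ≡ 0 mod (q - 1)` and `∑ i, r_i s_{i,ℓ} ≡ 0 mod n_ℓ` for every `ℓ`. -/
def feasible {h k : ℕ} {n : Fin h → ℕ} (q Q : ℕ) (s : Fin k → Grp n) : Set (Fin k → ℕ) :=
  {r | (∀ i, r i ≤ Q - 1) ∧ 0 < ∑ i, r i ∧ ∑ i, r i ≡ 0 [MOD (q - 1)] ∧
    ∀ ℓ, ∑ i, r i * (s i ℓ).val ≡ 0 [MOD n ℓ]}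

/-- The objective function `(1 / (p - 1)) ∑ i, S_p(r_i) - e`. -/
def objective {k : ℕ} (p e : ℕ) (r : Fin k → ℕ) : ℚ :=
  1 / ((p : ℚ) - 1) * ((∑ i, digitSum p (r i) : ℕ) : ℚ) - (e : ℚ)

end AbelianCode

/-!
Every function from `K ^ k` to the Witt vectors `W(K)` is, up to the unit `(|K| - 1) ^ k`, a
combination of the monomials `∏ i, T (α i) ^ r i` with `0 ≤ r i ≤ |K| - 1`, where `T` is the
Teichmüller lift. Hence a power of `p` divides all values of the function if and only if it divides
all its coefficients. Orthogonality of characters of the group shows that the coefficients of the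
weight function `α ↦ wt c(α)` are, up to the unit `∏ n_ℓ`, those of the indicator function of
`Tr (∑ a i) ≠ 0` for which `∑ r i * s i ℓ ≡ 0 mod n_ℓ`, and the others vanish. This leaves the
`p`-adic valuation of one coefficient of the indicator function.

*Lower bound.* The indicator is `p`-adically close to a power with exponent `p ^ L * (q - 1)` of the
lifted trace, whose coefficients are sums of multinomial coefficients; Legendre's formula bounds the
valuations of these in terms of digit sums.

*Exactness.* Up to the factor `-q`, the coefficients of the indicator are those of
`∑ ψ (y Tr (∑ a i))`, which are products of Gauss sums. By `g(χ) g(χ⁻¹) = χ(-1) |K|`, the product of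
the coefficients at `r` and `|K| - 1 - r` has exactly the sum of the two lower bounds as its
valuation, so both bounds are attained. The characters `ψ` take values only in an extension of
`W(K)`, but both sides of this identity lie in `W(K)` already.
-/

namespace AbelianCode

section Digits

variable {p : ℕ}

lemma digitSum_zero : digitSum p 0 = 0 := by simp [digitSum]

lemma digitSum_eq_mod_add_div (hp : 1 < p) (n : ℕ) :
    digitSum p n = n % p + digitSum p (n / p) := by
  rcases Nat.eq_zero_or_pos n with rfl | hn
  · simp [digitSum]
  · simp [digitSum, Nat.digits_def' hp hn]

lemma digitSum_mul_add (hp : 1 < p) (a : ℕ) {d : ℕ} (hd : d < p) :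
    digitSum p (p * a + d) = d + digitSum p a := by
  rw [digitSum_eq_mod_add_div hp, Nat.mul_add_mod, Nat.mod_eq_of_lt hd,
    Nat.mul_add_div (by omega), Nat.div_eq_of_lt hd, add_zero]

lemma digitSum_pow_mul_add (hp : 1 < p) (L a : ℕ) {v : ℕ} (hv : v < p ^ L) :
    digitSum p (p ^ L * a + v) = digitSum p a + digitSum p v := by
  induction L generalizing v with
  | zero =>
    obtain rfl : v = 0 := by simpa using hv
    simp [digitSum_zero]
  | succ L ih =>
    have hdiv : v / p < p ^ L := Nat.div_lt_of_lt_mul (by rwa [← pow_succ'])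
    have hmod : v % p < p := Nat.mod_lt _ (by omega)
    have hsplit : p ^ (L + 1) * a + v = p * (p ^ L * a + v / p) + v % p := by
      conv_lhs => rw [← Nat.div_add_mod v p]
      ring
    rw [hsplit, digitSum_mul_add hp _ hmod, ih hdiv, digitSum_eq_mod_add_div hp v]
    ring

lemma digitSum_pow_mul (hp : 1 < p) (L a : ℕ) : digitSum p (p ^ L * a) = digitSum p a := by
  simpa [digitSum_zero] using digitSum_pow_mul_add hp L a (v := 0) (by positivity)

lemma digitSum_add_digitSum_pow_sub_one_sub (hp : 1 < p) (L : ℕ) {r : ℕ} (hr : r ≤ p ^ L - 1) :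
    digitSum p r + digitSum p (p ^ L - 1 - r) = L * (p - 1) := by
  induction L generalizing r with
  | zero =>
    obtain rfl : r = 0 := by simpa using hr
    simp [digitSum_zero]
  | succ L ih =>
    have hpos : 0 < p ^ (L + 1) := by positivity
    have hdiv : r / p < p ^ L := Nat.div_lt_of_lt_mul (by rw [← pow_succ']; omega)
    have hmod : r % p < p := Nat.mod_lt _ (by omega)
    have hsplit : p ^ (L + 1) - 1 - r = p * (p ^ L - 1 - r / p) + (p - 1 - r % p) := by
      have hr' := Nat.div_add_mod r p
      have hquot : p * (p ^ L - 1 - r / p) + p * (r / p) + p = p ^ (L + 1) := by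
        rw [← mul_add, ← Nat.mul_succ, pow_succ']
        congr 1
        omega
      omega
    have hquot := ih (r := r / p) (by omega)
    rw [hsplit, digitSum_mul_add hp _ (by omega), digitSum_eq_mod_add_div hp r, Nat.succ_mul]
    omega

lemma digitSum_pow_sub_one (hp : 1 < p) (L : ℕ) : digitSum p (p ^ L - 1) = L * (p - 1) := by
  simpa [digitSum_zero] using digitSum_add_digitSum_pow_sub_one_sub hp L (Nat.zero_le _)

section Prime

variable [hp : Fact p.Prime]

lemma sub_one_mul_factorization_factorial_add_digitSum (n : ℕ) :
    (p - 1) * (n.factorial).factorization p + digitSum p n = n := by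
  rw [Nat.factorization_def _ hp.out, sub_one_mul_padicValNat_factorial]
  exact Nat.sub_add_cancel (Nat.digit_sum_le p n)

lemma sub_one_mul_factorization_multinomial_add_digitSum {ι : Type*} (s : Finset ι) (f : ι → ℕ) :
    (p - 1) * (Nat.multinomial s f).factorization p + digitSum p (∑ i ∈ s, f i) =
      ∑ i ∈ s, digitSum p (f i) := by
  have hfact : ∑ i ∈ s, ((f i).factorial).factorization p +
      (Nat.multinomial s f).factorization p = ((∑ i ∈ s, f i).factorial).factorization p := by
    rw [← Nat.multinomial_spec s f, Nat.factorization_mul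
      (Finset.prod_ne_zero_iff.2 fun i _ => Nat.factorial_ne_zero _)
      (Nat.multinomial_pos s f).ne', Finsupp.add_apply,
      Nat.factorization_prod_apply fun i _ => Nat.factorial_ne_zero _]
  have hsum := sub_one_mul_factorization_factorial_add_digitSum (p := p) (∑ i ∈ s, f i)
  have hparts : ∑ i ∈ s, ((p - 1) * ((f i).factorial).factorization p + digitSum p (f i)) =
      ∑ i ∈ s, f i :=
    Finset.sum_congr rfl fun i _ => sub_one_mul_factorization_factorial_add_digitSum (f i)
  rw [Finset.sum_add_distrib, ← Finset.mul_sum] at hparts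
  rw [← hfact, mul_add] at hsum
  omega

lemma pow_dvd_multinomial {ι : Type*} {s : Finset ι} {f : ι → ℕ} {x : ℕ}
    (hx : (p - 1) * x + digitSum p (∑ i ∈ s, f i) ≤ ∑ i ∈ s, digitSum p (f i)) :
    p ^ x ∣ Nat.multinomial s f := by
  rw [← sub_one_mul_factorization_multinomial_add_digitSum s f] at hx
  rw [hp.out.pow_dvd_iff_le_factorization (Nat.multinomial_pos _ _).ne']
  exact Nat.le_of_mul_le_mul_left (Nat.le_of_add_le_add_right hx)
    (Nat.sub_pos_of_lt hp.out.one_lt)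

lemma digitSum_sum_le {ι : Type*} (s : Finset ι) (f : ι → ℕ) :
    digitSum p (∑ i ∈ s, f i) ≤ ∑ i ∈ s, digitSum p (f i) := by
  rw [← sub_one_mul_factorization_multinomial_add_digitSum s f]
  exact Nat.le_add_left _ _

lemma digitSum_add_le (a b : ℕ) : digitSum p (a + b) ≤ digitSum p a + digitSum p b := by
  simpa using digitSum_sum_le (p := p) Finset.univ ![a, b]

lemma sum_digitSum_modEq {ι : Type*} (s : Finset ι) (f : ι → ℕ) :
    ∑ i ∈ s, digitSum p (f i) ≡ ∑ i ∈ s, f i [MOD p - 1] := by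
  rw [← sub_one_mul_factorization_multinomial_add_digitSum s f]
  nth_rw 2 [← sub_one_mul_factorization_factorial_add_digitSum (p := p) (∑ i ∈ s, f i)]
  simp [Nat.ModEq]

lemma div_add_mod_modEq_sub_one {Q : ℕ} (hQ : 0 < Q) (n : ℕ) :
    n / Q + n % Q ≡ n [MOD Q - 1] := by
  conv_rhs => rw [← Nat.div_add_mod n Q]
  refine Nat.ModEq.add_right _ ?_
  have hone : Q ≡ 1 [MOD Q - 1] := ((Nat.modEq_iff_dvd' hQ).2 dvd_rfl).symm
  simpa using (hone.mul_right (n / Q)).symm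

lemma eq_of_modEq_of_pos_of_le {N a b : ℕ} (h : a ≡ b [MOD N]) (ha : 0 < a) (haN : a ≤ N)
    (hb : 0 < b) (hbN : b ≤ N) : a = b := by
  have hpred : a - 1 ≡ b - 1 [MOD N] := by
    refine Nat.ModEq.add_right_cancel' 1 ?_
    rwa [Nat.sub_add_cancel ha, Nat.sub_add_cancel hb]
  have := hpred.eq_of_lt_of_lt (by omega) (by omega)
  omega

lemma digitSum_le_of_modEq {L r n : ℕ} (hr0 : 0 < r) (hr : r ≤ p ^ L - 1) (hn : 0 < n)
    (h : n ≡ r [MOD p ^ L - 1]) : digitSum p r ≤ digitSum p n := by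
  induction n using Nat.strong_induction_on with
  | _ n ih =>
    rcases Nat.lt_or_ge n (p ^ L) with hlt | hge
    · rw [eq_of_modEq_of_pos_of_le h hn (Nat.le_sub_one_of_lt hlt) hr0 hr]
    · -- Adding the upper digits to the lower ones keeps the residue and does not raise the sum.
      have hQ : 1 < p ^ L := by omega
      have hmod : n % p ^ L < p ^ L := Nat.mod_lt _ (by omega)
      have hdiv : 0 < n / p ^ L := Nat.div_pos hge (by omega)
      have hlt : n / p ^ L + n % p ^ L < n := by
        conv_rhs => rw [← Nat.div_add_mod n (p ^ L)]
        exact Nat.add_lt_add_right (lt_mul_of_one_lt_left hdiv hQ) _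
      calc digitSum p r ≤ digitSum p (n / p ^ L + n % p ^ L) :=
            ih _ hlt (Nat.add_pos_left hdiv _)
              ((div_add_mod_modEq_sub_one (zero_lt_one.trans hQ) n).trans h)
        _ ≤ digitSum p (n / p ^ L) + digitSum p (n % p ^ L) := digitSum_add_le _ _
        _ = digitSum p n := by
            rw [← digitSum_pow_mul_add hp.out.one_lt _ _ hmod, Nat.div_add_mod]

lemma sum_digitSum_le_of_modEq {ι : Type*} [Fintype ι] {L e m : ℕ} {r : ι → ℕ} {k : ι × Fin m → ℕ}
    (hr : ∀ i, r i ≤ p ^ L - 1)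
    (hk : ∀ i, (r i = 0 ↔ ∑ b : Fin m, (p ^ e) ^ (b : ℕ) * k (i, b) = 0) ∧
      ∑ b : Fin m, (p ^ e) ^ (b : ℕ) * k (i, b) ≡ r i [MOD p ^ L - 1]) :
    ∑ i, digitSum p (r i) ≤ ∑ j, digitSum p (k j) := by
  rw [Fintype.sum_prod_type]
  refine Finset.sum_le_sum fun i _ => ?_
  rcases Nat.eq_zero_or_pos (r i) with h0 | h0
  · simp [h0, digitSum_zero]
  calc digitSum p (r i) ≤ digitSum p (∑ b : Fin m, (p ^ e) ^ (b : ℕ) * k (i, b)) :=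
        digitSum_le_of_modEq h0 (hr i) (Nat.pos_of_ne_zero (mt (hk i).1.2 h0.ne')) (hk i).2
    _ ≤ ∑ b : Fin m, digitSum p ((p ^ e) ^ (b : ℕ) * k (i, b)) := digitSum_sum_le _ _
    _ = ∑ b, digitSum p (k (i, b)) := by simp only [← pow_mul, digitSum_pow_mul hp.out.one_lt]

section Sum

variable {ι : Type*} {s : Finset ι} {r : ι → ℕ} {e : ℕ}

lemma sub_one_dvd_sum_digitSum (hd : p ^ e - 1 ∣ ∑ i ∈ s, r i) :
    p - 1 ∣ ∑ i ∈ s, digitSum p (r i) := by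
  have hpe : p - 1 ∣ p ^ e - 1 := by simpa using Nat.sub_dvd_pow_sub_pow p 1 e
  exact (sum_digitSum_modEq s r).dvd_iff dvd_rfl |>.2 (hpe.trans hd)

lemma mul_sub_one_le_sum_digitSum (h0 : 0 < ∑ i ∈ s, r i) (hd : p ^ e - 1 ∣ ∑ i ∈ s, r i) :
    e * (p - 1) ≤ ∑ i ∈ s, digitSum p (r i) := by
  rcases Nat.eq_zero_or_pos e with rfl | he
  · simp
  have hq : 1 < p ^ e := Nat.one_lt_pow he.ne' hp.out.one_lt
  have hmod : ∑ i ∈ s, r i ≡ p ^ e - 1 [MOD p ^ e - 1] :=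
    (Nat.modEq_zero_iff_dvd.2 hd).trans (by simp [Nat.ModEq])
  rw [← digitSum_pow_sub_one hp.out.one_lt]
  exact (digitSum_le_of_modEq (by omega) le_rfl h0 hmod).trans (digitSum_sum_le _ _)

lemma exists_sum_digitSum_eq_mul_add (h0 : 0 < ∑ i ∈ s, r i) (hd : p ^ e - 1 ∣ ∑ i ∈ s, r i) :
    ∃ x, ∑ i ∈ s, digitSum p (r i) = (p - 1) * (x + e) := by
  obtain ⟨z, hz⟩ := sub_one_dvd_sum_digitSum hd
  have hle : e ≤ z := by
    have := mul_sub_one_le_sum_digitSum h0 hd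
    rw [hz, mul_comm e] at this
    exact Nat.le_of_mul_le_mul_left this (Nat.sub_pos_of_lt hp.out.one_lt)
  exact ⟨z - e, by rw [hz, Nat.sub_add_cancel hle]⟩

lemma sum_digitSum_add_sum_digitSum_pow_sub_one_sub {L : ℕ} (hr : ∀ i ∈ s, r i ≤ p ^ L - 1) :
    ∑ i ∈ s, digitSum p (r i) + ∑ i ∈ s, digitSum p (p ^ L - 1 - r i) =
      (p - 1) * (L * s.card) := by
  rw [← Finset.sum_add_distrib, Finset.sum_congr rfl fun i hi =>
    digitSum_add_digitSum_pow_sub_one_sub hp.out.one_lt L (hr i hi), Finset.sum_const, smul_eq_mul]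
  ring

end Sum

end Prime

end Digits

section Monomials

lemma dvd_sub_add_iff_modEq {N r n : ℕ} (hr : r ≤ N) : N ∣ N - r + n ↔ n ≡ r [MOD N] := by
  rw [Nat.modEq_iff_dvd, ← Int.natCast_dvd_natCast, Nat.cast_add, Nat.cast_sub hr, sub_add,
    dvd_sub_self_left]

variable {K R : Type*} [Field K] [CommRing R]

/-- A multiplicative map preserving zero, viewed as a multiplicative character of the field. -/
def toMulChar (T : K →*₀ R) : MulChar K R where
  toMonoidHom := T
  map_nonunit' a ha := by
    obtain rfl : a = 0 := by simpa using ha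
    simp

lemma toMulChar_apply (T : K →*₀ R) (a : K) : toMulChar T a = T a := rfl

variable [Fintype K]

lemma toMulChar_pow_eq_one_iff {T : K →*₀ R} (hT : Function.Injective T) {n : ℕ} :
    toMulChar T ^ n = 1 ↔ Fintype.card K - 1 ∣ n := by
  rw [← FiniteField.forall_pow_eq_one_iff, MulChar.eq_one_iff]
  refine forall_congr' fun u => ?_
  rw [MulChar.pow_apply_coe, toMulChar_apply, ← map_pow, ← map_one T, hT.eq_iff,
    ← Units.val_pow_eq_pow_val, Units.val_eq_one]

lemma map_pow_card_sub_one (T : K →*₀ R) {a : K} (ha : a ≠ 0) :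
    T a ^ (Fintype.card K - 1) = 1 := by
  rw [← map_pow, FiniteField.pow_card_sub_one_eq_one a ha, map_one]

lemma card_sub_one_eq_cast : (Fintype.card K : R) - 1 = ((Fintype.card K - 1 : ℕ) : R) := by
  rw [Nat.cast_sub Fintype.card_pos, Nat.cast_one]

lemma sum_map_pow [IsDomain R] {T : K →*₀ R} (hT : Function.Injective T) (n : ℕ) :
    ∑ a, T a ^ n = if n = 0 then (Fintype.card K : R)
      else if Fintype.card K - 1 ∣ n then (Fintype.card K : R) - 1 else 0 := by
  classical
  rcases eq_or_ne n 0 with rfl | hn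
  · simp
  have hsum : ∑ a, T a ^ n = ∑ a, (toMulChar T ^ n) a :=
    Finset.sum_congr rfl fun a _ => (MulChar.pow_apply' (toMulChar T) hn a).symm
  rw [hsum, if_neg hn]
  split_ifs with hdvd
  · rw [(toMulChar_pow_eq_one_iff hT).2 hdvd, MulChar.sum_one_eq_card_units, Fintype.card_units,
      card_sub_one_eq_cast]
  · exact MulChar.sum_eq_zero_of_ne_one (mt (toMulChar_pow_eq_one_iff hT).1 hdvd)

variable [DecidableEq K]

/-- The system dual (up to the factor `|K| - 1`) to the monomials `a ↦ T a ^ r` with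
`0 ≤ r ≤ |K| - 1`. The exponents `0` and `|K| - 1` give monomials that differ only at `a = 0`,
which the values at `a = 0` have to separate. -/
def dualMonomial (T : K →*₀ R) (r : ℕ) (a : K) : R :=
  if r = 0 then if a = 0 then (Fintype.card K : R) - 1 else 0
  else T a ^ (Fintype.card K - 1 - r) - if r = Fintype.card K - 1 ∧ a = 0 then
    (Fintype.card K : R) else 0

lemma sum_dualMonomial_zero_mul (T : K →*₀ R) (g : K → R) :
    ∑ a, dualMonomial T 0 a * g a = ((Fintype.card K : R) - 1) * g 0 := by
  simp [dualMonomial]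

lemma sum_dualMonomial_mul (T : K →*₀ R) {r : ℕ} (hr : r ≠ 0) (g : K → R) :
    ∑ a, dualMonomial T r a * g a = ∑ a, T a ^ (Fintype.card K - 1 - r) * g a -
      if r = Fintype.card K - 1 then (Fintype.card K : R) * g 0 else 0 := by
  simp [dualMonomial, hr, sub_mul, ite_and]

lemma sum_dualMonomial_mul_pow [IsDomain R] {T : K →*₀ R} (hT : Function.Injective T) {r : ℕ}
    (hr : r ≤ Fintype.card K - 1) (n : ℕ) :
    ∑ a, dualMonomial T r a * T a ^ n =
      if (r = 0 ↔ n = 0) ∧ n ≡ r [MOD Fintype.card K - 1] then (Fintype.card K : R) - 1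
      else 0 := by
  rcases eq_or_ne r 0 with rfl | hr0
  · rw [sum_dualMonomial_zero_mul]
    rcases eq_or_ne n 0 with rfl | hn <;> simp [*, Nat.ModEq.refl]
  rw [sum_dualMonomial_mul T hr0]
  simp only [← pow_add, sum_map_pow hT, dvd_sub_add_iff_modEq hr, map_zero, hr0, false_iff]
  rcases eq_or_ne n 0 with rfl | hn
  · have hmod : 0 ≡ r [MOD Fintype.card K - 1] ↔ r = Fintype.card K - 1 := by
      refine ⟨fun h => ?_, fun h => by simp [h, Nat.ModEq]⟩
      exact hr.antisymm (Nat.le_of_dvd (by omega) (Nat.modEq_zero_iff_dvd.1 h.symm))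
    have hsub : Fintype.card K - 1 - r = 0 ↔ r = Fintype.card K - 1 := by omega
    by_cases h : r = Fintype.card K - 1 <;> simp [hmod, hsub, h]
  · simp [hn]

lemma dualMonomial_apply_zero (T : K →*₀ R) {r : ℕ} (hr : r ≤ Fintype.card K - 1) :
    dualMonomial T r 0 = ((Fintype.card K : R) - 1) *
      ((if r = 0 then 1 else 0) - if r = Fintype.card K - 1 then 1 else 0) := by
  have hQ : Fintype.card K - 1 ≠ 0 := Nat.sub_ne_zero_of_lt Fintype.one_lt_card
  rcases eq_or_ne r 0 with rfl | hr0
  · simp [dualMonomial, hQ.symm]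
  by_cases hlast : r = Fintype.card K - 1
  · simp [dualMonomial, hlast, hQ]
  · simp [dualMonomial, hlast, hr0, show Fintype.card K - 1 - r ≠ 0 by omega]

lemma dualMonomial_apply_of_ne (T : K →*₀ R) (r : ℕ) {a : K} (ha : a ≠ 0) :
    dualMonomial T r a = if r = 0 then 0 else T a ^ (Fintype.card K - 1 - r) := by
  simp [dualMonomial, ha]

omit [DecidableEq K] in
lemma map_mul_geom_sum₂_eq_zero [IsDomain R] {T : K →*₀ R} (hT : Function.Injective T) {a x : K}
    (ha : a ≠ 0) (hxa : x ≠ a) :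
    T x * ∑ r ∈ Finset.range (Fintype.card K - 1), T x ^ r * T a ^ (Fintype.card K - 1 - 1 - r) =
      0 := by
  rcases eq_or_ne x 0 with rfl | hx
  · simp
  have hgeom := (Commute.all (T x) (T a)).geom_sum₂_mul (Fintype.card K - 1)
  rw [map_pow_card_sub_one T hx, map_pow_card_sub_one T ha, sub_self] at hgeom
  rw [(mul_eq_zero.1 hgeom).resolve_right (sub_ne_zero.2 (hT.ne hxa)), mul_zero]

lemma sum_range_dualMonomial_mul_pow [IsDomain R] {T : K →*₀ R} (hT : Function.Injective T)
    (a x : K) : ∑ r ∈ Finset.range (Fintype.card K), dualMonomial T r a * T x ^ r =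
      if x = a then (Fintype.card K : R) - 1 else 0 := by
  rw [← Nat.sub_add_cancel (Fintype.card_pos (α := K))]
  rcases eq_or_ne a 0 with rfl | ha
  · rw [Finset.sum_congr rfl fun r hr => by
      rw [dualMonomial_apply_zero T (Nat.le_of_lt_succ (Finset.mem_range.1 hr))]]
    simp only [mul_assoc, ← Finset.mul_sum, sub_mul, ite_mul, one_mul, zero_mul,
      Finset.sum_sub_distrib, Finset.sum_ite_eq', Finset.mem_range, Nat.lt_succ_self,
      Nat.succ_pos, if_true, pow_zero]
    rcases eq_or_ne x 0 with rfl | hx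
    · simp [Nat.sub_ne_zero_of_lt (Fintype.one_lt_card (α := K)), card_sub_one_eq_cast]
    · simp [hx, map_pow_card_sub_one T hx]
  have hshift : ∑ r ∈ Finset.range (Fintype.card K - 1 + 1), dualMonomial T r a * T x ^ r =
      T x * ∑ r ∈ Finset.range (Fintype.card K - 1),
        T x ^ r * T a ^ (Fintype.card K - 1 - 1 - r) := by
    simp only [Finset.sum_range_succ', dualMonomial_apply_of_ne T _ ha, Finset.mul_sum,
      Nat.add_one_ne_zero, if_true, if_false, zero_mul, add_zero]
    refine Finset.sum_congr rfl fun r _ => ?_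
    rw [Nat.sub_sub _ 1 r, add_comm 1 r]
    ring
  rw [hshift]
  split_ifs with hxa
  · subst hxa
    rw [Finset.mul_sum, Finset.sum_congr rfl (g := fun _ => (1 : R))]
    · simp
    · intro r hr
      rw [Finset.mem_range] at hr
      rw [← pow_add, ← pow_succ', Nat.add_sub_cancel' (Nat.le_sub_one_of_lt hr),
        Nat.sub_add_cancel (by omega), map_pow_card_sub_one T ha]
  · exact map_mul_geom_sum₂_eq_zero hT ha hxa

lemma dualMonomial_div (T : K →*₀ R) {r : ℕ} (hr : r ≤ Fintype.card K - 1) (a : K) {y : K}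
    (hy : y ≠ 0) : dualMonomial T r (a / y) = T y ^ r * dualMonomial T r a := by
  rcases eq_or_ne r 0 with rfl | hr0
  · simp [dualMonomial, hy]
  have hmul : T y ^ r * T a ^ (Fintype.card K - 1 - r) = T (a / y) ^ (Fintype.card K - 1 - r) := by
    nth_rw 1 [← div_mul_cancel₀ a hy]
    rw [map_mul, mul_pow, mul_left_comm, ← pow_add, Nat.add_sub_cancel' hr,
      map_pow_card_sub_one T hy, mul_one]
  have hlast : T y ^ r * (if r = Fintype.card K - 1 ∧ a = 0 then (Fintype.card K : R) else 0) =
      if r = Fintype.card K - 1 ∧ a = 0 then (Fintype.card K : R) else 0 := by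
    split_ifs with h
    · rw [h.1, map_pow_card_sub_one T hy, one_mul]
    · exact mul_zero _
  simp only [dualMonomial, hr0, if_false, mul_sub, hmul, hlast, div_eq_zero_iff, hy, or_false]

lemma map_dualMonomial {R' : Type*} [CommRing R'] (φ : R →+* R') (T : K →*₀ R) (r : ℕ) (a : K) :
    φ (dualMonomial T r a) = dualMonomial (φ.toMonoidWithZeroHom.comp T) r a := by
  simp only [dualMonomial]
  split_ifs <;> simp

variable {ι : Type*} [Fintype ι] [DecidableEq ι]

/-- `(|K| - 1) ^ |ι|` times the coefficient of the monomial `a ↦ ∏ i, T (a i) ^ r i` in the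
expansion of a function on `K ^ ι`, for exponents `0 ≤ r i ≤ |K| - 1`. -/
def monomialCoeff (T : K →*₀ R) (r : ι → ℕ) : ((ι → K) → R) →ₗ[R] R :=
  ∑ a, (∏ i, dualMonomial T (r i) (a i)) • LinearMap.proj a

lemma monomialCoeff_apply (T : K →*₀ R) (r : ι → ℕ) (f : (ι → K) → R) :
    monomialCoeff T r f = ∑ a, (∏ i, dualMonomial T (r i) (a i)) * f a := by
  simp [monomialCoeff]

lemma monomialCoeff_prod (T : K →*₀ R) (r : ι → ℕ) (g : ι → K → R) :
    monomialCoeff T r (fun a => ∏ i, g i (a i)) = ∏ i, ∑ a, dualMonomial T (r i) a * g i a := by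
  rw [Finset.prod_univ_sum, Fintype.piFinset_univ, monomialCoeff_apply]
  simp only [Finset.prod_mul_distrib]

lemma monomialCoeff_zero (T : K →*₀ R) (f : (ι → K) → R) :
    monomialCoeff T 0 f = ((Fintype.card K : R) - 1) ^ Fintype.card ι * f 0 := by
  rw [monomialCoeff_apply, Finset.sum_eq_single 0]
  · simp [dualMonomial]
  · intro a _ ha
    obtain ⟨i, hi⟩ := Function.ne_iff.1 ha
    have hfactor : dualMonomial T 0 (a i) = 0 := by simp [dualMonomial, show a i ≠ 0 from hi]
    exact mul_eq_zero_of_left (Finset.prod_eq_zero (Finset.mem_univ i) hfactor) _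
  · simp

lemma monomialCoeff_monomial [IsDomain R] {T : K →*₀ R} (hT : Function.Injective T) {r : ι → ℕ}
    (hr : ∀ i, r i ≤ Fintype.card K - 1) (n : ι → ℕ) :
    monomialCoeff T r (fun a => ∏ i, T (a i) ^ n i) =
      if ∀ i, (r i = 0 ↔ n i = 0) ∧ n i ≡ r i [MOD Fintype.card K - 1] then
        ((Fintype.card K : R) - 1) ^ Fintype.card ι else 0 := by
  rw [monomialCoeff_prod T r fun i a => T a ^ n i]
  simp only [sum_dualMonomial_mul_pow hT (hr _)]
  rw [Finset.prod_ite_zero]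
  simp

lemma monomialCoeff_comp_mul (T : K →*₀ R) {r : ι → ℕ} (hr : ∀ i, r i ≤ Fintype.card K - 1)
    (f : (ι → K) → R) {y : ι → K} (hy : ∀ i, y i ≠ 0) :
    monomialCoeff T r (fun a => f (a * y)) = (∏ i, T (y i) ^ r i) * monomialCoeff T r f := by
  let scale : (ι → K) ≃ (ι → K) := Equiv.piCongrRight fun i => Equiv.mulRight₀ (y i) (hy i)
  rw [monomialCoeff_apply, monomialCoeff_apply, Finset.mul_sum]
  refine Fintype.sum_equiv scale _ _ fun a => ?_
  rw [← mul_assoc, ← Finset.prod_mul_distrib]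
  congr 1
  refine Finset.prod_congr rfl fun i _ => ?_
  rw [← dualMonomial_div T (hr i) _ (hy i)]
  simp [scale, hy i]

lemma map_monomialCoeff {R' : Type*} [CommRing R'] (φ : R →+* R') (T : K →*₀ R) (r : ι → ℕ)
    (f : (ι → K) → R) :
    φ (monomialCoeff T r f) = monomialCoeff (φ.toMonoidWithZeroHom.comp T) r (φ ∘ f) := by
  simp [monomialCoeff_apply, map_dualMonomial]

lemma sum_monomialCoeff_mul_prod_pow [IsDomain R] {T : K →*₀ R} (hT : Function.Injective T)
    (f : (ι → K) → R) (x : ι → K) :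
    ∑ r ∈ Fintype.piFinset fun _ : ι => Finset.range (Fintype.card K),
      monomialCoeff T r f * ∏ i, T (x i) ^ r i =
      ((Fintype.card K : R) - 1) ^ Fintype.card ι * f x := by
  have hdual (a : ι → K) : ∑ r ∈ Fintype.piFinset fun _ : ι => Finset.range (Fintype.card K),
      (∏ i, dualMonomial T (r i) (a i)) * ∏ i, T (x i) ^ r i =
      if x = a then ((Fintype.card K : R) - 1) ^ Fintype.card ι else 0 := by
    simp only [← Finset.prod_mul_distrib]
    rw [← Finset.prod_univ_sum (fun _ : ι => Finset.range (Fintype.card K))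
      (fun i r => dualMonomial T r (a i) * T (x i) ^ r)]
    simp only [sum_range_dualMonomial_mul_pow hT]
    rw [Finset.prod_ite_zero]
    simp [funext_iff]
  simp only [monomialCoeff_apply, Finset.sum_mul]
  rw [Finset.sum_comm]
  simp only [mul_right_comm _ (f _), ← Finset.sum_mul, hdual]
  simp

theorem forall_dvd_iff_forall_dvd_monomialCoeff [IsDomain R] {T : K →*₀ R}
    (hT : Function.Injective T) (hK : IsUnit ((Fintype.card K : R) - 1)) {d : R}
    {f : (ι → K) → R} :
    (∀ x, d ∣ f x) ↔ ∀ r : ι → ℕ, (∀ i, r i ≤ Fintype.card K - 1) → d ∣ monomialCoeff T r f := by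
  refine ⟨fun hf r _ => ?_, fun hf x => ?_⟩
  · rw [monomialCoeff_apply]
    exact Finset.dvd_sum fun a _ => (hf a).mul_left _
  · rw [← (hK.pow (Fintype.card ι)).dvd_mul_left, ← sum_monomialCoeff_mul_prod_pow hT]
    refine Finset.dvd_sum fun r hr => (hf r fun i => ?_).mul_right _
    have := Fintype.mem_piFinset.1 hr i
    exact Nat.le_sub_one_of_lt (Finset.mem_range.1 this)

end Monomials

section TraceCharacter

variable {F K R ι : Type*} [Field F] [Field K] [Algebra F K] [CommRing R] [Fintype ι]

/-- The additive character `ψ ∘ Tr` of `K`. -/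
noncomputable def traceChar (K : Type*) [Field K] [Algebra F K] (ψ : AddChar F R) : AddChar K R :=
  ψ.compAddMonoidHom (Algebra.trace F K).toAddMonoidHom

lemma traceChar_inv (ψ : AddChar F R) : traceChar K ψ⁻¹ = (traceChar K ψ)⁻¹ := by
  ext a
  simp [traceChar, AddChar.inv_apply]

lemma traceChar_ne_one [FiniteDimensional F K] [Algebra.IsSeparable F K] {ψ : AddChar F R}
    (hψ : ψ ≠ 1) : traceChar K ψ ≠ 1 := by
  obtain ⟨y, hy⟩ := AddChar.ne_one_iff.1 hψ
  obtain ⟨a, rfl⟩ := Algebra.trace_surjective F K y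
  exact AddChar.ne_one_iff.2 ⟨a, hy⟩

lemma trace_sum_mul_algebraMap (a : ι → K) (y : F) :
    Algebra.trace F K (∑ i, a i * algebraMap F K y) = y * Algebra.trace F K (∑ i, a i) := by
  rw [← Finset.sum_mul, mul_comm, ← Algebra.smul_def, map_smul, smul_eq_mul]

lemma prod_traceChar (ψ : AddChar F R) (a : ι → K) :
    ∏ i, traceChar K ψ (a i) = ψ (Algebra.trace F K (∑ i, a i)) :=
  (map_prod (traceChar K ψ).toMonoidHom (fun i => Multiplicative.ofAdd (a i)) Finset.univ).symm

variable [DecidableEq F]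

/-- The indicator function of the vectors `a` with `Tr (∑ i, a i) ≠ 0`. -/
noncomputable def traceInd (F : Type*) {K R ι : Type*} [Field F] [Field K] [Algebra F K]
    [CommRing R] [Fintype ι] [DecidableEq F] (a : ι → K) : R :=
  if Algebra.trace F K (∑ i, a i) = 0 then 0 else 1

/-- The sum of `ψ (Tr (y * ∑ i, a i))` over `0 ≠ y ∈ F`, for any nontrivial additive character `ψ`
of `F`; it is defined by its values, so that it makes sense also where no such `ψ` exists. -/
noncomputable def traceCharSum (F : Type*) {K R ι : Type*} [Field F] [Field K] [Algebra F K]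
    [CommRing R] [Fintype ι] [DecidableEq F] [Fintype F] (a : ι → K) : R :=
  if Algebra.trace F K (∑ i, a i) = 0 then (Fintype.card F : R) - 1 else -1

lemma traceInd_mul_algebraMap (a : ι → K) {y : F} (hy : y ≠ 0) :
    traceInd F (a * fun _ => algebraMap F K y) = (traceInd F a : R) := by
  simp only [traceInd, Pi.mul_apply, trace_sum_mul_algebraMap, mul_eq_zero, hy, false_or]

variable [Fintype F]

lemma traceInd_eq_map_trace_pow (T : K →*₀ R) {N : ℕ}
    (hN : N ≠ 0) (a : ι → K) : traceInd F a =
      T (algebraMap F K (Algebra.trace F K (∑ i, a i))) ^ (N * (Fintype.card F - 1)) := by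
  rw [traceInd]
  split_ifs with h0
  · rw [h0, map_zero, map_zero,
      zero_pow (mul_ne_zero hN (Nat.sub_ne_zero_of_lt Fintype.one_lt_card))]
  · rw [mul_comm, pow_mul, ← map_pow, ← map_pow (algebraMap F K),
      FiniteField.pow_card_sub_one_eq_one _ h0, map_one, map_one, one_pow]

lemma traceCharSum_eq_sub_traceInd (a : ι → K) :
    traceCharSum F a = ((Fintype.card F : R) - 1) - Fintype.card F * traceInd F a := by
  unfold traceCharSum traceInd
  split_ifs <;> ring

lemma traceCharSum_eq_sum [IsDomain R] {ψ : AddChar F R} (hψ : ψ ≠ 1) (a : ι → K) :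
    traceCharSum F a =
      ∑ y ∈ Finset.univ.erase (0 : F), ∏ i, traceChar K ψ (a i * algebraMap F K y) := by
  simp only [prod_traceChar, trace_sum_mul_algebraMap]
  rw [Finset.sum_erase_eq_sub (Finset.mem_univ 0),
    AddChar.sum_mulShift _ (AddChar.IsPrimitive.of_ne_one hψ), traceCharSum]
  split_ifs <;> simp

lemma map_traceCharSum {R' : Type*} [CommRing R'] (φ : R →+* R') (a : ι → K) :
    φ (traceCharSum F a) = traceCharSum F a := by
  simp [traceCharSum, apply_ite φ]

end TraceCharacter

section Gauss

lemma card_sub_one_dvd_card_sub_one (F K : Type*) [Field F] [Fintype F] [Field K] [Fintype K]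
    [Algebra F K] : Fintype.card F - 1 ∣ Fintype.card K - 1 := by
  rw [Module.card_eq_pow_finrank (K := F) (V := K)]
  simpa using Nat.sub_dvd_pow_sub_pow (Fintype.card F) 1 _

lemma card_eq_pow_mul_finrank {F K : Type*} [Field F] [Fintype F] [Field K] [Fintype K]
    [Algebra F K] {p e : ℕ} (hF : Fintype.card F = p ^ e) :
    Fintype.card K = p ^ (e * Module.finrank F K) := by
  rw [Module.card_eq_pow_finrank (K := F) (V := K), hF, pow_mul]

lemma dvd_sum_sub_of_dvd_sum {ι : Type*} {s : Finset ι} {r : ι → ℕ} {d N : ℕ} (hN : d ∣ N)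
    (hr : ∀ i ∈ s, r i ≤ N) (hd : d ∣ ∑ i ∈ s, r i) : d ∣ ∑ i ∈ s, (N - r i) := by
  refine (Nat.dvd_add_left hd).1 ?_
  rw [← Finset.sum_add_distrib]
  exact Finset.dvd_sum fun i hi => by rwa [Nat.sub_add_cancel (hr i hi)]

lemma exists_injective_ringHom_addChar_ne_one.{u} (F : Type*) [Field F] [Finite F] (R : Type u)
    [CommRing R] [IsDomain R] (hR : ringChar R ≠ ringChar F) :
    ∃ (E : Type u) (_ : CommRing E) (_ : IsDomain E) (φ : R →+* E) (ψ : AddChar F E),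
      Function.Injective φ ∧ ψ ≠ 1 := by
  have hinj := IsFractionRing.injective R (FractionRing R)
  have hchar : ringChar (FractionRing R) ≠ ringChar F := by
    have := charP_of_injective_algebraMap hinj (ringChar R)
    rwa [ringChar.eq (FractionRing R) (ringChar R)]
  let P := AddChar.FiniteField.primitiveChar F (FractionRing R) hchar
  have hP : P.char ≠ 1 := by simpa [AddChar.mulShift_one] using P.prim one_ne_zero
  exact ⟨CyclotomicField P.n (FractionRing R), inferInstance, inferInstance,
    (algebraMap _ _).comp (algebraMap R (FractionRing R)), P.char,
    (algebraMap (FractionRing R) _).injective.comp hinj, hP⟩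

variable {K R : Type*} [Field K] [Fintype K] [DecidableEq K] [CommRing R]

/-- `|K| - 1` times the coefficient of `a ↦ T a ^ r` in the expansion of the additive character
`Ψ`; a Gauss sum unless `r` is `0` or `|K| - 1`. -/
def gaussCoeff (T : K →*₀ R) (Ψ : AddChar K R) (r : ℕ) : R := ∑ a, dualMonomial T r a * Ψ a

lemma gaussCoeff_zero (T : K →*₀ R) (Ψ : AddChar K R) :
    gaussCoeff T Ψ 0 = (Fintype.card K : R) - 1 := by
  simp [gaussCoeff, sum_dualMonomial_zero_mul]

lemma gaussCoeff_eq_gaussSum (T : K →*₀ R) (Ψ : AddChar K R) {r : ℕ} (hr0 : 0 < r)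
    (hr : r < Fintype.card K - 1) :
    gaussCoeff T Ψ r = gaussSum (toMulChar T ^ (Fintype.card K - 1 - r)) Ψ := by
  have hpow (a : K) : (toMulChar T ^ (Fintype.card K - 1 - r)) a =
      T a ^ (Fintype.card K - 1 - r) :=
    MulChar.pow_apply' (toMulChar T) (Nat.sub_ne_zero_of_lt hr) a
  simp [gaussCoeff, sum_dualMonomial_mul T hr0.ne', hr.ne, gaussSum, hpow]

variable [IsDomain R]

lemma gaussCoeff_card_sub_one (T : K →*₀ R) {Ψ : AddChar K R} (hΨ : Ψ ≠ 1) :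
    gaussCoeff T Ψ (Fintype.card K - 1) = -(Fintype.card K : R) := by
  rw [gaussCoeff, sum_dualMonomial_mul T (Nat.sub_ne_zero_of_lt Fintype.one_lt_card)]
  simp [AddChar.sum_eq_zero_of_ne_one hΨ]

lemma gaussCoeff_mul_gaussCoeff_inv {T : K →*₀ R} (hT : Function.Injective T) {Ψ : AddChar K R}
    (hΨ : Ψ ≠ 1) {r : ℕ} (hr : r ≤ Fintype.card K - 1) :
    gaussCoeff T Ψ r * gaussCoeff T Ψ⁻¹ (Fintype.card K - 1 - r) =
      Fintype.card K * if 0 < r ∧ r < Fintype.card K - 1 then 1 else 1 - (Fintype.card K : R) := by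
  split_ifs with hmid
  · have hinv : toMulChar T ^ r = (toMulChar T ^ (Fintype.card K - 1 - r))⁻¹ := by
      rw [eq_inv_iff_mul_eq_one, ← pow_add, Nat.add_sub_cancel' hr, toMulChar_pow_eq_one_iff hT]
    have hne : toMulChar T ^ (Fintype.card K - 1 - r) ≠ 1 := fun h =>
      absurd (Nat.le_of_dvd (by omega) ((toMulChar_pow_eq_one_iff hT).1 h)) (by omega)
    rw [gaussCoeff_eq_gaussSum T Ψ hmid.1 hmid.2,
      gaussCoeff_eq_gaussSum T Ψ⁻¹ (by omega) (by omega), Nat.sub_sub_self hr, hinv,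
      gaussSum_mul_gaussSum_eq_card hne (AddChar.IsPrimitive.of_ne_one hΨ), mul_one]
  · obtain rfl | rfl : r = 0 ∨ r = Fintype.card K - 1 := by omega
    · rw [Nat.sub_zero, gaussCoeff_zero, gaussCoeff_card_sub_one T (inv_ne_one.2 hΨ)]
      ring
    · rw [Nat.sub_self, gaussCoeff_zero, gaussCoeff_card_sub_one T hΨ]
      ring

variable {F ι : Type*} [Field F] [Fintype F] [DecidableEq F] [Algebra F K]
  [Fintype ι] [DecidableEq ι]

lemma monomialCoeff_traceInd_eq_zero {T : K →*₀ R} (hT : Function.Injective T) {r : ι → ℕ}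
    (hr : ∀ i, r i ≤ Fintype.card K - 1) (hd : ¬ Fintype.card F - 1 ∣ ∑ i, r i) :
    monomialCoeff T r (traceInd F) = 0 := by
  obtain ⟨u, hu⟩ : ∃ u : Fˣ, u ^ ∑ i, r i ≠ 1 := by
    simpa using (FiniteField.forall_pow_eq_one_iff F _).not.2 hd
  have hscale := monomialCoeff_comp_mul T hr (traceInd F) (y := fun _ => algebraMap F K u)
    (by simp)
  simp only [traceInd_mul_algebraMap _ u.ne_zero, Finset.prod_pow_eq_pow_sum] at hscale
  by_contra h0
  have hpow : T (algebraMap F K u) ^ ∑ i, r i = 1 := (right_eq_mul₀ h0).1 hscale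
  rw [← map_pow, ← map_one T, hT.eq_iff, ← map_pow, ← map_one (algebraMap F K),
    (algebraMap F K).injective.eq_iff] at hpow
  exact hu (Units.ext (by simpa using hpow))

lemma monomialCoeff_traceCharSum_eq_neg_mul {T : K →*₀ R} (hT : Function.Injective T) {r : ι → ℕ}
    (hr : ∀ i, r i ≤ Fintype.card K - 1) (h0 : 0 < ∑ i, r i) :
    monomialCoeff T r (traceCharSum F) =
      -((Fintype.card F : R) * monomialCoeff T r (traceInd F)) := by
  have hone : monomialCoeff T r 1 = 0 := by
    obtain ⟨i, -, hi⟩ := Finset.exists_ne_zero_of_sum_ne_zero h0.ne'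
    have hmono := monomialCoeff_monomial hT hr 0
    rw [if_neg fun h => hi ((h i).1.2 rfl)] at hmono
    simpa [Pi.one_def] using hmono
  have hsub : (traceCharSum F : (ι → K) → R) =
      ((Fintype.card F : R) - 1) • 1 - (Fintype.card F : R) • traceInd F := by
    ext a
    simp [traceCharSum_eq_sub_traceInd]
  rw [hsub, map_sub, map_smul, map_smul, hone, smul_zero, zero_sub, smul_eq_mul]

lemma monomialCoeff_traceCharSum (T : K →*₀ R) {ψ : AddChar F R} (hψ : ψ ≠ 1) {r : ι → ℕ}
    (hr : ∀ i, r i ≤ Fintype.card K - 1) (hd : Fintype.card F - 1 ∣ ∑ i, r i) :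
    monomialCoeff T r (traceCharSum F) =
      ((Fintype.card F : R) - 1) * ∏ i, gaussCoeff T (traceChar K ψ) (r i) := by
  have hscale (y : F) (hy : y ∈ Finset.univ.erase 0) :
      monomialCoeff T r (fun a => ∏ i, traceChar K ψ (a i * algebraMap F K y)) =
        ∏ i, gaussCoeff T (traceChar K ψ) (r i) := by
    have hy0 : y ≠ 0 := Finset.ne_of_mem_erase hy
    have hpow : T (algebraMap F K y) ^ ∑ i, r i = 1 := by
      obtain ⟨c, hc⟩ := hd
      rw [hc, pow_mul, ← map_pow, ← map_pow (algebraMap F K),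
        FiniteField.pow_card_sub_one_eq_one y hy0, map_one, map_one, one_pow]
    refine (monomialCoeff_comp_mul T hr (fun a => ∏ i, traceChar K ψ (a i))
      (y := fun _ => algebraMap F K y) (fun _ => by simpa using hy0)).trans ?_
    rw [Finset.prod_pow_eq_pow_sum, hpow, one_mul, monomialCoeff_prod T r fun _ => traceChar K ψ]
    rfl
  have hsum : (traceCharSum F : (ι → K) → R) = ∑ y ∈ Finset.univ.erase (0 : F),
      fun a => ∏ i, traceChar K ψ (a i * algebraMap F K y) := by
    ext a
    rw [traceCharSum_eq_sum hψ, Finset.sum_apply]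
  rw [hsum, map_sum, Finset.sum_congr rfl hscale, Finset.sum_const, nsmul_eq_mul,
    Finset.card_erase_of_mem (Finset.mem_univ 0), Finset.card_univ, ← card_sub_one_eq_cast]

lemma monomialCoeff_traceCharSum_mul_reflect_of_addChar {T : K →*₀ R} (hT : Function.Injective T)
    {ψ : AddChar F R} (hψ : ψ ≠ 1) {r : ι → ℕ} (hr : ∀ i, r i ≤ Fintype.card K - 1)
    (hd : Fintype.card F - 1 ∣ ∑ i, r i) :
    monomialCoeff T r (traceCharSum F) *
      monomialCoeff T (fun i => Fintype.card K - 1 - r i) (traceCharSum F) =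
      ((Fintype.card F : R) - 1) ^ 2 * ∏ i, (Fintype.card K *
        if 0 < r i ∧ r i < Fintype.card K - 1 then 1 else 1 - (Fintype.card K : R)) := by
  have hd' : Fintype.card F - 1 ∣ ∑ i, (Fintype.card K - 1 - r i) :=
    dvd_sum_sub_of_dvd_sum (card_sub_one_dvd_card_sub_one F K) (fun i _ => hr i) hd
  rw [monomialCoeff_traceCharSum T hψ hr hd,
    monomialCoeff_traceCharSum T (inv_ne_one.2 hψ) (fun i => Nat.sub_le _ _) hd', traceChar_inv,
    mul_mul_mul_comm, ← sq, ← Finset.prod_mul_distrib]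
  simp only [gaussCoeff_mul_gaussCoeff_inv hT (traceChar_ne_one hψ) (hr _)]

theorem monomialCoeff_traceCharSum_mul_reflect {T : K →*₀ R} (hT : Function.Injective T)
    (hR : ringChar R ≠ ringChar F) {r : ι → ℕ} (hr : ∀ i, r i ≤ Fintype.card K - 1)
    (hd : Fintype.card F - 1 ∣ ∑ i, r i) :
    monomialCoeff T r (traceCharSum F) *
      monomialCoeff T (fun i => Fintype.card K - 1 - r i) (traceCharSum F) =
      ((Fintype.card F : R) - 1) ^ 2 * ∏ i, (Fintype.card K *
        if 0 < r i ∧ r i < Fintype.card K - 1 then 1 else 1 - (Fintype.card K : R)) := by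
  obtain ⟨E, _, _, φ, ψ, hφ, hψ⟩ := exists_injective_ringHom_addChar_ne_one F R hR
  have hmap (r : ι → ℕ) : φ (monomialCoeff T r (traceCharSum F)) =
      monomialCoeff (φ.toMonoidWithZeroHom.comp T) r (traceCharSum F) := by
    rw [map_monomialCoeff]
    congr 1
    exact funext fun a => map_traceCharSum φ a
  apply hφ
  rw [map_mul, hmap, hmap,
    monomialCoeff_traceCharSum_mul_reflect_of_addChar (hφ.comp hT) hψ hr hd]
  simp [apply_ite φ]

end Gauss

section Witt

lemma associated_of_dvd_of_associated_mul {R : Type*} [CommRing R] [IsDomain R] {a b x y : R}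
    (hx : a ∣ x) (hy : b ∣ y) (hab : a * b ≠ 0) (h : Associated (x * y) (a * b)) :
    Associated x a := by
  obtain ⟨c, rfl⟩ := hx
  obtain ⟨d, rfl⟩ := hy
  rw [mul_mul_mul_comm] at h
  have hunit : IsUnit (c * d) := by
    obtain ⟨u, hu⟩ := h.symm
    exact mul_left_cancel₀ hab hu ▸ u.isUnit
  exact (associated_mul_unit_left a c (isUnit_of_mul_isUnit_left hunit))

variable {p : ℕ} [hp : Fact p.Prime] {K : Type*} [Field K]

/-- The Teichmüller lift, as a multiplicative map preserving zero. -/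
noncomputable def teichmullerHom (p : ℕ) [Fact p.Prime] (K : Type*) [Field K] :
    K →*₀ WittVector p K :=
  { WittVector.teichmuller p with map_zero' := WittVector.teichmuller_zero p }

lemma constantCoeff_teichmullerHom (a : K) :
    WittVector.constantCoeff (teichmullerHom p K a) = a :=
  WittVector.teichmuller_coeff_zero p a

lemma teichmullerHom_injective : Function.Injective (teichmullerHom p K) :=
  Function.LeftInverse.injective constantCoeff_teichmullerHom

variable [CharP K p]

lemma isUnit_of_constantCoeff_ne_zero {x : WittVector p K}
    (hx : WittVector.constantCoeff x ≠ 0) : IsUnit x :=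
  WittVector.isUnit_of_coeff_zero_ne_zero x hx

lemma isUnit_natCast_sub_one {n : ℕ} (hn : p ∣ n) : IsUnit ((n : WittVector p K) - 1) := by
  apply isUnit_of_constantCoeff_ne_zero
  rw [map_sub, map_natCast, map_one]
  simp [(CharP.cast_eq_zero_iff K p n).2 hn]

lemma constantCoeff_eq_zero_of_prime_dvd {x : WittVector p K} (h : (p : WittVector p K) ∣ x) :
    WittVector.constantCoeff x = 0 := by
  obtain ⟨y, rfl⟩ := h
  rw [map_mul, map_natCast, CharP.cast_eq_zero, zero_mul]

lemma natCast_prime_ne_zero : (p : WittVector p K) ≠ 0 := (WittVector.irreducible p).ne_zero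

lemma prime_dvd_of_constantCoeff_eq_zero [PerfectRing K p] {x : WittVector p K}
    (h : WittVector.constantCoeff x = 0) : (p : WittVector p K) ∣ x := by
  rcases eq_or_ne x 0 with rfl | hx
  · exact dvd_zero _
  obtain ⟨m, b, hb, rfl⟩ := WittVector.exists_eq_pow_p_mul x hx
  rcases Nat.eq_zero_or_pos m with rfl | hm
  · exact absurd (by simpa using h) hb
  · exact (dvd_pow_self _ hm.ne').mul_right _

lemma prime_pow_dvd_natCast_iff {t n : ℕ} :
    (p : WittVector p K) ^ t ∣ (n : WittVector p K) ↔ p ^ t ∣ n := by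
  refine ⟨fun h => ?_, fun ⟨y, hy⟩ => ⟨y, by simp [hy]⟩⟩
  induction t generalizing n with
  | zero => simp
  | succ t ih =>
    have hcoeff := constantCoeff_eq_zero_of_prime_dvd ((dvd_pow_self _ t.succ_ne_zero).trans h)
    rw [map_natCast, CharP.cast_eq_zero_iff K p] at hcoeff
    obtain ⟨n, rfl⟩ := hcoeff
    rw [pow_succ'] at h ⊢
    rw [Nat.cast_mul, mul_dvd_mul_iff_left natCast_prime_ne_zero] at h
    exact mul_dvd_mul_left _ (ih h)

lemma ringChar_wittVector_ne : ringChar (WittVector p K) ≠ p := by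
  intro h
  have hcast := ringChar.Nat.cast_ringChar (R := WittVector p K)
  rw [h] at hcast
  exact natCast_prime_ne_zero hcast

end Witt

section TraceLift

variable {p : ℕ} [hp : Fact p.Prime] {F K ι : Type*} [Field F] [Fintype F] [Field K]
  [Algebra F K] [Fintype ι]

/-- A lift of `a ↦ Tr (∑ i, a i)` to the Witt vectors: the sum of the Teichmüller lifts of the
conjugates of the `a i`. -/
noncomputable def traceLift (p : ℕ) [Fact p.Prime] (F : Type*) {K ι : Type*} [Field F]
    [Fintype F] [Field K] [Algebra F K] [Fintype ι] (a : ι → K) : WittVector p K :=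
  ∑ j : ι × Fin (Module.finrank F K), teichmullerHom p K (a j.1) ^ Fintype.card F ^ (j.2 : ℕ)

lemma traceLift_pow [DecidableEq ι] (N : ℕ) : (traceLift p F ^ N : (ι → K) → WittVector p K) =
    ∑ k ∈ Finset.univ.piAntidiag N, (Nat.multinomial Finset.univ k : WittVector p K) •
      fun a => ∏ i, teichmullerHom p K (a i) ^
        ∑ b : Fin (Module.finrank F K), Fintype.card F ^ (b : ℕ) * k (i, b) := by
  ext1 a
  simp only [Pi.pow_apply, traceLift, Finset.sum_pow_eq_sum_piAntidiag, Fintype.prod_prod_type,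
    ← pow_mul, Finset.prod_pow_eq_pow_sum, Finset.sum_apply, Pi.smul_apply, smul_eq_mul]

variable [CharP K p] [Finite K]

lemma prime_dvd_traceLift_sub (a : ι → K) : (p : WittVector p K) ∣
    traceLift p F a - teichmullerHom p K (algebraMap F K (Algebra.trace F K (∑ i, a i))) := by
  apply prime_dvd_of_constantCoeff_eq_zero
  rw [traceLift, map_sub, map_sum, sub_eq_zero, constantCoeff_teichmullerHom, map_sum, map_sum]
  simp only [map_pow, constantCoeff_teichmullerHom, FiniteField.algebraMap_trace_eq_sum_pow,
    Fintype.sum_prod_type, Finset.sum_range, Nat.card_eq_fintype_card]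

lemma pow_dvd_traceLift_pow_sub_traceInd [DecidableEq F] (L : ℕ) (a : ι → K) :
    (p : WittVector p K) ^ (L + 1) ∣
      traceLift p F a ^ (p ^ L * (Fintype.card F - 1)) - traceInd F a := by
  rw [traceInd_eq_map_trace_pow (teichmullerHom p K) (pow_ne_zero L hp.out.ne_zero), pow_mul,
    pow_mul]
  exact (dvd_sub_pow_of_dvd_sub (prime_dvd_traceLift_sub a) L).trans (sub_dvd_pow_sub_pow _ _ _)

end TraceLift

section Valuation

variable {p : ℕ} [hp : Fact p.Prime] {e : ℕ} {F K ι : Type*} [Field F] [Fintype F]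
  [Field K] [CharP K p] [Fintype K] [DecidableEq K] [Algebra F K] [Fintype ι] [DecidableEq ι]

lemma pow_dvd_monomialCoeff_traceLift_pow (hF : Fintype.card F = p ^ e) {r : ι → ℕ}
    (hr : ∀ i, r i ≤ Fintype.card K - 1) {x : ℕ}
    (hx : ∑ i, digitSum p (r i) = (p - 1) * (x + e)) (L : ℕ) :
    (p : WittVector p K) ^ x ∣ monomialCoeff (teichmullerHom p K) r
      (traceLift p F ^ (p ^ L * (Fintype.card F - 1))) := by
  rw [traceLift_pow, map_sum]
  refine Finset.dvd_sum fun k hk => ?_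
  rw [map_smul, monomialCoeff_monomial teichmullerHom_injective hr, smul_eq_mul]
  split_ifs with hmod
  · refine Dvd.dvd.mul_right (prime_pow_dvd_natCast_iff.2 (pow_dvd_multinomial ?_)) _
    rw [hF] at hk hmod
    rw [card_eq_pow_mul_finrank hF] at hr hmod
    have hN : digitSum p (p ^ L * (p ^ e - 1)) = e * (p - 1) := by
      rw [digitSum_pow_mul hp.out.one_lt, digitSum_pow_sub_one hp.out.one_lt]
    rw [(Finset.mem_piAntidiag.1 hk).1, hN, mul_comm e, ← mul_add, ← hx]
    exact sum_digitSum_le_of_modEq hr hmod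
  · rw [mul_zero]
    exact dvd_zero _

variable [DecidableEq F]

lemma pow_dvd_monomialCoeff_traceInd (hF : Fintype.card F = p ^ e) {r : ι → ℕ}
    (hr : ∀ i, r i ≤ Fintype.card K - 1) {x : ℕ}
    (hx : ∑ i, digitSum p (r i) = (p - 1) * (x + e)) :
    (p : WittVector p K) ^ x ∣ monomialCoeff (teichmullerHom p K) r (traceInd F) := by
  refine (dvd_sub_right (pow_dvd_monomialCoeff_traceLift_pow hF hr hx x)).1 ?_
  rw [← map_sub, monomialCoeff_apply]
  refine Finset.dvd_sum fun a _ => Dvd.dvd.mul_left ?_ _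
  exact (pow_dvd_pow _ x.le_succ).trans (pow_dvd_traceLift_pow_sub_traceInd x a)

lemma pow_dvd_monomialCoeff_traceCharSum (hF : Fintype.card F = p ^ e) {r : ι → ℕ}
    (hr : ∀ i, r i ≤ Fintype.card K - 1) (hd : Fintype.card F - 1 ∣ ∑ i, r i) {z : ℕ}
    (hz : ∑ i, digitSum p (r i) = (p - 1) * z) :
    (p : WittVector p K) ^ z ∣ monomialCoeff (teichmullerHom p K) r (traceCharSum F) := by
  have hp1 : 0 < p - 1 := Nat.sub_pos_of_lt hp.out.one_lt
  rcases Nat.eq_zero_or_pos (∑ i, r i) with h0 | h0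
  · have hz0 : z = 0 := by
      have hdig : ∑ i, digitSum p (r i) = 0 := Finset.sum_eq_zero fun i hi => by
        rw [Finset.sum_eq_zero_iff.1 h0 i hi, digitSum_zero]
      exact (Nat.mul_eq_zero.1 (hz.symm.trans hdig)).resolve_left hp1.ne'
    rw [hz0, pow_zero]
    exact one_dvd _
  · obtain ⟨x, hx⟩ := exists_sum_digitSum_eq_mul_add h0 (hF ▸ hd)
    obtain rfl : z = x + e := Nat.eq_of_mul_eq_mul_left hp1 (hz.symm.trans hx)
    rw [monomialCoeff_traceCharSum_eq_neg_mul teichmullerHom_injective hr h0, hF, add_comm,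
      pow_add, Nat.cast_pow, dvd_neg]
    exact mul_dvd_mul_left _ (pow_dvd_monomialCoeff_traceInd hF hr hx)

lemma associated_monomialCoeff_traceCharSum_mul_reflect (hF : Fintype.card F = p ^ e) {r : ι → ℕ}
    (hr : ∀ i, r i ≤ Fintype.card K - 1) (hd : Fintype.card F - 1 ∣ ∑ i, r i) :
    Associated (monomialCoeff (teichmullerHom p K) r (traceCharSum F) *
        monomialCoeff (teichmullerHom p K) (fun i => Fintype.card K - 1 - r i) (traceCharSum F))
      ((p : WittVector p K) ^ (e * Module.finrank F K * Fintype.card ι)) := by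
  have : CharP F p := (Algebra.charP_iff F K p).2 inferInstance
  have hpF : p ∣ Fintype.card F :=
    (CharP.cast_eq_zero_iff F p _).1 (FiniteField.cast_card_eq_zero F)
  have hpK : p ∣ Fintype.card K :=
    (CharP.cast_eq_zero_iff K p _).1 (FiniteField.cast_card_eq_zero K)
  have hunit : IsUnit (∏ i, if 0 < r i ∧ r i < Fintype.card K - 1 then 1
      else 1 - (Fintype.card K : WittVector p K)) := by
    refine IsUnit.prod_iff.2 fun i _ => ?_
    split_ifs
    · exact isUnit_one
    · rw [← neg_sub]
      exact (isUnit_natCast_sub_one hpK).neg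
  have hR : ringChar (WittVector p K) ≠ ringChar F := by
    rw [ringChar.eq F p]
    exact ringChar_wittVector_ne
  rw [monomialCoeff_traceCharSum_mul_reflect teichmullerHom_injective hR hr hd,
    associated_isUnit_mul_left_iff ((isUnit_natCast_sub_one hpF).pow 2), Finset.prod_mul_distrib,
    associated_mul_isUnit_left_iff hunit, Finset.prod_const, Finset.card_univ,
    card_eq_pow_mul_finrank hF, Nat.cast_pow, ← pow_mul]

theorem associated_monomialCoeff_traceCharSum (hF : Fintype.card F = p ^ e) {r : ι → ℕ}
    (hr : ∀ i, r i ≤ Fintype.card K - 1) (hd : Fintype.card F - 1 ∣ ∑ i, r i) {z : ℕ}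
    (hz : ∑ i, digitSum p (r i) = (p - 1) * z) :
    Associated (monomialCoeff (teichmullerHom p K) r (traceCharSum F))
      ((p : WittVector p K) ^ z) := by
  have hdig := sum_digitSum_add_sum_digitSum_pow_sub_one_sub (p := p) (s := Finset.univ) (r := r)
    (L := e * Module.finrank F K) fun i _ => card_eq_pow_mul_finrank (K := K) hF ▸ hr i
  rw [← card_eq_pow_mul_finrank hF] at hdig
  have hd' : Fintype.card F - 1 ∣ ∑ i, (Fintype.card K - 1 - r i) :=
    dvd_sum_sub_of_dvd_sum (card_sub_one_dvd_card_sub_one F K) (fun i _ => hr i) hd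
  obtain ⟨z', hz'⟩ : p - 1 ∣ ∑ i, digitSum p (Fintype.card K - 1 - r i) :=
    sub_one_dvd_sum_digitSum (hF ▸ hd')
  rw [hz, hz', ← mul_add] at hdig
  have hzz' : z + z' = e * Module.finrank F K * Fintype.card ι :=
    Nat.eq_of_mul_eq_mul_left (Nat.sub_pos_of_lt hp.out.one_lt) hdig
  have hpow (n : ℕ) : (p : WittVector p K) ^ n ≠ 0 := pow_ne_zero n natCast_prime_ne_zero
  refine associated_of_dvd_of_associated_mul (pow_dvd_monomialCoeff_traceCharSum hF hr hd hz)
    (pow_dvd_monomialCoeff_traceCharSum hF (fun i => Nat.sub_le _ _) hd' hz')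
    (mul_ne_zero (hpow z) (hpow z')) ?_
  rw [← pow_add, hzz']
  exact associated_monomialCoeff_traceCharSum_mul_reflect hF hr hd

theorem associated_monomialCoeff_traceInd (hF : Fintype.card F = p ^ e) {r : ι → ℕ}
    (hr : ∀ i, r i ≤ Fintype.card K - 1) (h0 : 0 < ∑ i, r i)
    (hd : Fintype.card F - 1 ∣ ∑ i, r i) {x : ℕ}
    (hx : ∑ i, digitSum p (r i) = (p - 1) * (x + e)) :
    Associated (monomialCoeff (teichmullerHom p K) r (traceInd F)) ((p : WittVector p K) ^ x) := by
  have hassoc := associated_monomialCoeff_traceCharSum hF hr hd hx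
  rw [monomialCoeff_traceCharSum_eq_neg_mul teichmullerHom_injective hr h0, hF, add_comm, pow_add,
    Nat.cast_pow, Associated.neg_left_iff] at hassoc
  exact hassoc.of_mul_left (Associated.refl _) (pow_ne_zero _ natCast_prime_ne_zero)

end Valuation

section Characters

variable {h : ℕ} {n : Fin h → ℕ} {R : Type*} [CommRing R]

/-- The representatives of the components of `s` in `[0, n_ℓ - 1]`, used as exponents. -/
def Grp.val (s : Grp n) (ℓ : Fin h) : ℕ := (s ℓ).val

/-- The map `j ↦ ∏ ℓ, γ_ℓ ^ (v_ℓ j_ℓ)`, a character of `ℤ/n₁ × ⋯ × ℤ/n_h` when every `γ_ℓ` is an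
`n_ℓ`-th root of unity. The exponents `v_ℓ` are natural numbers, so that one can add up the
exponents of several characters. -/
def chi (γ : Fin h → R) (v : Fin h → ℕ) (j : Grp n) : R := ∏ ℓ, γ ℓ ^ (v ℓ * (j ℓ).val)

lemma expMatrix_apply {K : Type*} [Field K] {k : ℕ} (γ : Fin h → K) (s : Fin k → Grp n) (i : Fin k)
    (j : Grp n) : expMatrix γ s i j = chi γ (s i).val j := rfl

lemma chi_val_comm (γ : Fin h → R) (s j : Grp n) : chi γ s.val j = chi γ j.val s := by
  simp only [chi, Grp.val, mul_comm]

lemma chi_ne_zero [IsDomain R] {γ : Fin h → R} (hγ : ∀ ℓ, γ ℓ ≠ 0) (v : Fin h → ℕ) (j : Grp n) :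
    chi γ v j ≠ 0 :=
  Finset.prod_ne_zero_iff.2 fun ℓ _ => pow_ne_zero _ (hγ ℓ)

lemma map_chi {K : Type*} [CommRing K] (T : K →*₀ R) (γ : Fin h → K) (v : Fin h → ℕ) (j : Grp n) :
    T (chi γ v j) = chi (T ∘ γ) v j := by
  simp only [chi, map_prod, map_pow, Function.comp_apply]

lemma prod_chi_pow {ι : Type*} [Fintype ι] (γ : Fin h → R) (v : ι → Fin h → ℕ) (r : ι → ℕ)
    (j : Grp n) : ∏ i, chi γ (v i) j ^ r i = chi γ (fun ℓ => ∑ i, r i * v i ℓ) j := by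
  simp only [chi, ← Finset.prod_pow, Finset.sum_mul, ← Finset.prod_pow_eq_pow_sum, ← pow_mul]
  rw [Finset.prod_comm]
  simp only [mul_comm (r _), mul_right_comm]

lemma prod_natCast_ne_zero [IsDomain R] (hn : ∀ ℓ, n ℓ ≠ 0) {γ : Fin h → R}
    (hγ : ∀ ℓ, IsPrimitiveRoot (γ ℓ) (n ℓ)) : ∏ ℓ, (n ℓ : R) ≠ 0 :=
  Finset.prod_ne_zero_iff.2 fun ℓ _ =>
    have : NeZero (n ℓ) := ⟨hn ℓ⟩
    (hγ ℓ).neZero'.out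

variable [∀ ℓ, NeZero (n ℓ)]

lemma chi_add {γ : Fin h → R} (hγ : ∀ ℓ, γ ℓ ^ n ℓ = 1) (v : Fin h → ℕ) (j j' : Grp n) :
    chi γ v (j + j') = chi γ v j * chi γ v j' := by
  simp only [chi, ← Finset.prod_mul_distrib]
  refine Finset.prod_congr rfl fun ℓ _ => ?_
  rw [← pow_add, ← mul_add, Pi.add_apply, ZMod.val_add, mul_comm, mul_comm _ (_ + _), pow_mul,
    pow_mul, ← pow_eq_pow_mod _ (hγ ℓ)]

variable [IsDomain R]

lemma sum_zmod_pow_mul_val {d : ℕ} [NeZero d] {ζ : R} (hζ : IsPrimitiveRoot ζ d) (v : ℕ) :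
    ∑ j : ZMod d, ζ ^ (v * j.val) = if d ∣ v then (d : R) else 0 := by
  have hrange : ∑ j : ZMod d, ζ ^ (v * j.val) = ∑ i ∈ Finset.range d, (ζ ^ v) ^ i := by
    obtain ⟨d, rfl⟩ := Nat.exists_eq_succ_of_ne_zero (NeZero.ne d)
    simp only [pow_mul]
    exact Fin.sum_univ_eq_sum_range (fun i => (ζ ^ v) ^ i) (d + 1)
  rw [hrange]
  split_ifs with hdvd
  · simp [(hζ.pow_eq_one_iff_dvd v).2 hdvd]
  · have hgeom := geom_sum_mul (ζ ^ v) d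
    rw [← pow_mul, mul_comm v, pow_mul, hζ.pow_eq_one, one_pow, sub_self, mul_eq_zero] at hgeom
    exact hgeom.resolve_right (sub_ne_zero.2 (mt (hζ.pow_eq_one_iff_dvd v).1 hdvd))

lemma sum_chi {γ : Fin h → R} (hγ : ∀ ℓ, IsPrimitiveRoot (γ ℓ) (n ℓ)) (v : Fin h → ℕ) :
    ∑ j : Grp n, chi γ v j = if ∀ ℓ, n ℓ ∣ v ℓ then ∏ ℓ, (n ℓ : R) else 0 := by
  have hprod := Finset.prod_univ_sum (fun ℓ => (Finset.univ : Finset (ZMod (n ℓ))))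
    (fun ℓ j => γ ℓ ^ (v ℓ * j.val))
  rw [Fintype.piFinset_univ] at hprod
  simp only [chi, ← hprod, sum_zmod_pow_mul_val (hγ _), Finset.prod_ite_zero, Finset.mem_univ,
    true_imp_iff]

lemma sum_chi_val {γ : Fin h → R} (hγ : ∀ ℓ, IsPrimitiveRoot (γ ℓ) (n ℓ)) (j : Grp n) :
    ∑ s : Grp n, chi γ s.val j = if j = 0 then ∏ ℓ, (n ℓ : R) else 0 := by
  simp only [chi_val_comm _ _ j, sum_chi hγ]
  refine if_congr ?_ rfl rfl
  rw [funext_iff]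
  refine forall_congr' fun ℓ => ?_
  rw [Grp.val, ← ZMod.natCast_eq_zero_iff, ZMod.natCast_zmod_val, Pi.zero_apply]

end Characters

section TraceWord

variable {F K A : Type*} [Field F] [Finite A]

/-- The element of the group algebra with prescribed coefficients. -/
noncomputable def word (f : A → F) : AddMonoidAlgebra F A :=
  .ofCoeff (Finsupp.equivFunOnFinite.symm f)

lemma coeff_word (f : A → F) (j : A) : (word f).coeff j = f j := rfl

lemma eq_word_iff {c : AddMonoidAlgebra F A} {f : A → F} : c = word f ↔ ∀ j, c.coeff j = f j :=
  ⟨fun h j => h ▸ coeff_word f j, fun h => AddMonoidAlgebra.coeff_injective (Finsupp.ext h)⟩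

lemma weight_word [Fintype A] [DecidableEq F] (f : A → F) :
    weight (word f) = ∑ j, if f j = 0 then 0 else 1 := by
  have hsupp : (word f).coeff.support = ({j | f j ≠ 0} : Finset A) := by
    ext j
    rw [Finsupp.mem_support_iff, Finset.mem_filter_univ, coeff_word]
  rw [weight, hsupp, Finset.card_filter]
  simp only [ne_eq, ite_not]

variable [Field K] [Algebra F K] {k : ℕ}

/-- The word with coefficients `Tr (∑ i, α i * G i j)`. -/
noncomputable def traceWord (F : Type*) {K A : Type*} [Field F] [Finite A] [Field K] [Algebra F K]
    {k : ℕ} (G : Matrix (Fin k) A K) (α : Fin k → K) : AddMonoidAlgebra F A :=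
  word fun j => Algebra.trace F K (∑ i, α i * G i j)

lemma isTraceCodeOf_iff {C : Set (AddMonoidAlgebra F A)} {G : Matrix (Fin k) A K} :
    IsTraceCodeOf C G ↔ C = Set.range (traceWord F G) := by
  simp only [IsTraceCodeOf, Set.ext_iff, Set.mem_range, traceWord, eq_comm, eq_word_iff]

end TraceWord

section Structure

variable {F K : Type*} [Field F] [Field K] [Algebra F K] {h : ℕ} {n : Fin h → ℕ}
  [∀ ℓ, NeZero (n ℓ)] {γ : Fin h → K}

/-- The Fourier transform of `c`, evaluated at the character with exponents `-s`. -/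
noncomputable def fourier (γ : Fin h → K) (c : AddMonoidAlgebra F (Grp n)) (s : Grp n) : K :=
  ∑ u, algebraMap F K (c.coeff u) * chi γ s.val (-u)

lemma sum_fourier_mul_chi (hγ : ∀ ℓ, IsPrimitiveRoot (γ ℓ) (n ℓ))
    (c : AddMonoidAlgebra F (Grp n)) (j : Grp n) :
    ∑ s : Grp n, fourier γ c s * chi γ s.val j = (∏ ℓ, (n ℓ : K)) * algebraMap F K (c.coeff j) := by
  simp only [fourier, Finset.sum_mul, mul_assoc, ← chi_add fun ℓ => (hγ ℓ).pow_eq_one]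
  rw [Finset.sum_comm]
  simp only [← Finset.mul_sum, sum_chi_val hγ, neg_add_eq_zero, mul_ite, mul_zero]
  rw [Finset.sum_ite_eq' Finset.univ j, if_pos (Finset.mem_univ j), mul_comm]

lemma mul_word_trace_chi (hγ : ∀ ℓ, γ ℓ ^ n ℓ = 1) (c : AddMonoidAlgebra F (Grp n)) (s : Grp n)
    (β : K) : (c * word fun j => Algebra.trace F K (β * chi γ s.val j)) =
      word fun j => Algebra.trace F K (β * fourier γ c s * chi γ s.val j) := by
  refine eq_word_iff.2 fun j => ?_
  rw [AddMonoidAlgebra.coeff_mul_apply_left, Finsupp.sum_fintype _ _ (by simp)]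
  simp only [coeff_word, chi_add hγ, fourier, Finset.mul_sum, Finset.sum_mul, map_sum]
  refine Finset.sum_congr rfl fun u _ => ?_
  rw [← smul_eq_mul (c.coeff u), ← map_smul, Algebra.smul_def]
  congr 1
  ring

lemma word_trace_chi_mem (hγ : ∀ ℓ, γ ℓ ^ n ℓ = 1) {C : Ideal (AddMonoidAlgebra F (Grp n))}
    {c : AddMonoidAlgebra F (Grp n)} (hc : c ∈ C) {s : Grp n} (hs : fourier γ c s ≠ 0) (β : K) :
    (word fun j => Algebra.trace F K (β * chi γ s.val j)) ∈ C := by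
  have hmem := C.mul_mem_right (word fun j =>
    Algebra.trace F K (β / fourier γ c s * chi γ s.val j)) hc
  rwa [mul_word_trace_chi hγ, div_mul_cancel₀ _ hs] at hmem

lemma exists_forall_coeff_eq_trace_sum [FiniteDimensional F K] [Algebra.IsSeparable F K]
    (hγ : ∀ ℓ, IsPrimitiveRoot (γ ℓ) (n ℓ)) :
    ∃ β : K, ∀ (c : AddMonoidAlgebra F (Grp n)) (j : Grp n),
      c.coeff j = Algebra.trace F K (∑ s : Grp n, β * fourier γ c s * chi γ s.val j) := by
  obtain ⟨β, hβ⟩ := Algebra.trace_surjective F K 1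
  refine ⟨β / ∏ ℓ, (n ℓ : K), fun c j => ?_⟩
  simp only [mul_assoc, ← Finset.mul_sum]
  rw [sum_fourier_mul_chi hγ, ← mul_assoc,
    div_mul_cancel₀ _ (prod_natCast_ne_zero (fun ℓ => NeZero.ne _) hγ), mul_comm,
    ← Algebra.smul_def, map_smul, hβ, smul_eq_mul, mul_one]

theorem exists_isTraceCodeOf [FiniteDimensional F K] [Algebra.IsSeparable F K]
    (hγ : ∀ ℓ, IsPrimitiveRoot (γ ℓ) (n ℓ)) (C : Ideal (AddMonoidAlgebra F (Grp n))) :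
    ∃ (k : ℕ) (s : Fin k → Grp n), Function.Injective s ∧
      IsTraceCodeOf (C : Set (AddMonoidAlgebra F (Grp n))) (expMatrix γ s) := by
  classical
  let S : Finset (Grp n) := {s | ∃ c ∈ C, fourier γ c s ≠ 0}
  let s (i : Fin S.card) : Grp n := S.equivFin.symm i
  have hS {s : Grp n} : s ∈ S ↔ ∃ c ∈ C, fourier γ c s ≠ 0 := by simp [S]
  refine ⟨S.card, s, Subtype.val_injective.comp S.equivFin.symm.injective, fun c => ⟨?_, ?_⟩⟩
  · intro hc
    obtain ⟨β, hβ⟩ := exists_forall_coeff_eq_trace_sum (F := F) hγ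
    refine ⟨fun i => β * fourier γ c (s i), fun j => (hβ c j).trans (congrArg _ ?_)⟩
    rw [← Finset.sum_subset (Finset.subset_univ S), ← Finset.sum_coe_sort S,
      ← S.equivFin.symm.sum_comp]
    · rfl
    · intro s _ hs
      have hzero : fourier γ c s = 0 := by
        by_contra h0
        exact hs (hS.2 ⟨c, hc, h0⟩)
      rw [hzero, mul_zero, zero_mul]
  · rintro ⟨α, hα⟩
    have hsum : c = ∑ i, word fun j => Algebra.trace F K (α i * chi γ (s i).val j) := by
      refine AddMonoidAlgebra.coeff_injective (Finsupp.ext fun j => ?_)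
      rw [hα j, AddMonoidAlgebra.coeff_sum, Finsupp.finsetSum_apply, map_sum]
      rfl
    rw [hsum]
    refine C.sum_mem fun i _ => ?_
    obtain ⟨c, hc, h0⟩ := hS.1 (S.equivFin.symm i).2
    exact word_trace_chi_mem (fun ℓ => (hγ ℓ).pow_eq_one) hc h0 (α i)

end Structure

section Weight

lemma isUnit_prod_natCast {p : ℕ} [Fact p.Prime] {K : Type*} [Field K] [CharP K p] {h : ℕ}
    {n : Fin h → ℕ} (hn : ∀ ℓ, n ℓ ≠ 0) {γ : Fin h → K} (hγ : ∀ ℓ, IsPrimitiveRoot (γ ℓ) (n ℓ)) :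
    IsUnit (∏ ℓ, (n ℓ : WittVector p K)) := by
  apply isUnit_of_constantCoeff_ne_zero
  simpa only [map_prod, map_natCast] using prod_natCast_ne_zero hn hγ

lemma pos_of_isTraceCodeOf {F K A : Type*} [Field F] [Field K] [Algebra F K] {k : ℕ}
    {C : Set (AddMonoidAlgebra F A)} {G : Matrix (Fin k) A K} (hC : IsTraceCodeOf C G)
    (h0 : ∃ c ∈ C, c ≠ 0) : 0 < k := by
  obtain ⟨c, hc, hc0⟩ := h0
  refine Nat.pos_of_ne_zero ?_
  rintro rfl
  obtain ⟨α, hα⟩ := (hC c).1 hc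
  exact hc0 (AddMonoidAlgebra.coeff_injective (Finsupp.ext fun j => by simp [hα j]))

variable {F K : Type*} [Field F] [Field K] [Algebra F K] {k : ℕ}

lemma natCast_weight_traceWord [DecidableEq F] {A R : Type*} [Fintype A] [CommRing R]
    (G : Matrix (Fin k) A K)
    (α : Fin k → K) :
    (weight (traceWord F G α) : R) = ∑ j, traceInd F (α * fun i => G i j) := by
  rw [traceWord, weight_word]
  push_cast
  rfl

variable [Fintype K]

lemma monomialCoeff_weight_traceWord [DecidableEq F] [DecidableEq K] {A R : Type*} [Fintype A]
    [CommRing R] (T : K →*₀ R) {G : Matrix (Fin k) A K} (hG : ∀ i j, G i j ≠ 0) {r : Fin k → ℕ}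
    (hr : ∀ i, r i ≤ Fintype.card K - 1) :
    monomialCoeff T r (fun α => (weight (traceWord F G α) : R)) =
      (∑ j, ∏ i, T (G i j) ^ r i) * monomialCoeff T r (traceInd F) := by
  have hsum : (fun α => (weight (traceWord F G α) : R)) =
      ∑ j, fun α => traceInd F (α * fun i => G i j) := by
    ext α
    rw [natCast_weight_traceWord, Finset.sum_apply]
  rw [hsum, map_sum, Finset.sum_mul]
  exact Finset.sum_congr rfl fun j _ => monomialCoeff_comp_mul T hr (traceInd F) fun i => hG i j

variable [Fintype F] {p e : ℕ} [hp : Fact p.Prime]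

lemma objective_eq {r : Fin k → ℕ} {x : ℕ}
    (hx : ∑ i, digitSum p (r i) = (p - 1) * (x + e)) : objective p e r = x := by
  have hp1 : (p : ℚ) - 1 ≠ 0 := sub_ne_zero.2 (by exact_mod_cast hp.out.one_lt.ne')
  rw [objective, hx]
  push_cast [Nat.cast_sub hp.out.one_lt.le]
  field_simp
  ring

variable [CharP K p]

lemma pow_dvd_monomialCoeff_traceInd_iff [DecidableEq F] [DecidableEq K]
    (hF : Fintype.card F = p ^ e) {r : Fin k → ℕ} (hr : ∀ i, r i ≤ Fintype.card K - 1) {t : ℕ} :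
    (p : WittVector p K) ^ t ∣ monomialCoeff (teichmullerHom p K) r (traceInd F) ↔
      (0 < ∑ i, r i → Fintype.card F - 1 ∣ ∑ i, r i → (t : ℚ) ≤ objective p e r) := by
  by_cases hd : Fintype.card F - 1 ∣ ∑ i, r i
  swap
  · simp [monomialCoeff_traceInd_eq_zero teichmullerHom_injective hr hd, hd]
  rcases Nat.eq_zero_or_pos (∑ i, r i) with h0 | h0
  · obtain rfl : r = 0 := funext fun i => Finset.sum_eq_zero_iff.1 h0 i (Finset.mem_univ i)
    simp [monomialCoeff_zero, traceInd]
  obtain ⟨x, hx⟩ := exists_sum_digitSum_eq_mul_add h0 (hF ▸ hd)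
  rw [(associated_monomialCoeff_traceInd hF hr h0 hd hx).dvd_iff_dvd_right, objective_eq hx,
    Nat.cast_le, pow_dvd_pow_iff natCast_prime_ne_zero (WittVector.irreducible p).not_isUnit]
  simp only [h0, hd, true_imp_iff]

variable {h : ℕ} {n : Fin h → ℕ} [∀ ℓ, NeZero (n ℓ)] {γ : Fin h → K}

lemma pow_dvd_monomialCoeff_weight_traceWord_iff [DecidableEq K] (hF : Fintype.card F = p ^ e)
    (hγ : ∀ ℓ, IsPrimitiveRoot (γ ℓ) (n ℓ)) (s : Fin k → Grp n) {r : Fin k → ℕ}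
    (hr : ∀ i, r i ≤ Fintype.card K - 1) {t : ℕ} :
    (p : WittVector p K) ^ t ∣ monomialCoeff (teichmullerHom p K) r
        (fun α => (weight (traceWord F (expMatrix γ s) α) : WittVector p K)) ↔
      (r ∈ feasible (Fintype.card F) (Fintype.card K) s → (t : ℚ) ≤ objective p e r) := by
  classical
  have hchar : ∑ j, ∏ i, teichmullerHom p K (expMatrix γ s i j) ^ r i =
      if ∀ ℓ, n ℓ ∣ ∑ i, r i * (s i ℓ).val then ∏ ℓ, (n ℓ : WittVector p K) else 0 := by
    simp only [expMatrix_apply, map_chi, prod_chi_pow]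
    exact sum_chi (fun ℓ => (hγ ℓ).map_of_injective teichmullerHom_injective) _
  have hne (i : Fin k) (j : Grp n) : expMatrix γ s i j ≠ 0 :=
    chi_ne_zero (fun ℓ => (hγ ℓ).ne_zero (NeZero.ne _)) _ j
  rw [monomialCoeff_weight_traceWord _ hne hr, hchar]
  simp only [feasible, Set.mem_ofPred_eq, Nat.modEq_zero_iff_dvd]
  split_ifs with hs
  · rw [(isUnit_prod_natCast (fun ℓ => NeZero.ne _) hγ).dvd_mul_left,
      pow_dvd_monomialCoeff_traceInd_iff hF hr]
    tauto
  · simp [hs]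

theorem isDivisible_pow_iff_forall_le_objective (hF : Fintype.card F = p ^ e)
    (hγ : ∀ ℓ, IsPrimitiveRoot (γ ℓ) (n ℓ)) {s : Fin k → Grp n}
    {C : Set (AddMonoidAlgebra F (Grp n))} (hC : IsTraceCodeOf C (expMatrix γ s)) {t : ℕ} :
    IsDivisible (p ^ t) C ↔
      ∀ r ∈ feasible (Fintype.card F) (Fintype.card K) s, (t : ℚ) ≤ objective p e r := by
  classical
  have hunit : IsUnit ((Fintype.card K : WittVector p K) - 1) :=
    isUnit_natCast_sub_one ((CharP.cast_eq_zero_iff K p _).1 (FiniteField.cast_card_eq_zero K))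
  have hweight : IsDivisible (p ^ t) C ↔ ∀ α, (p : WittVector p K) ^ t ∣
      (weight (traceWord F (expMatrix γ s) α) : WittVector p K) := by
    rw [isTraceCodeOf_iff.1 hC, IsDivisible, Set.forall_mem_range]
    simp only [prime_pow_dvd_natCast_iff]
  rw [hweight, forall_dvd_iff_forall_dvd_monomialCoeff teichmullerHom_injective hunit]
  refine forall_congr' fun r => ⟨fun hdvd hr => ?_, fun hle hr => ?_⟩
  · exact (pow_dvd_monomialCoeff_weight_traceWord_iff hF hγ s hr.1).1 (hdvd hr.1) hr
  · exact (pow_dvd_monomialCoeff_weight_traceWord_iff hF hγ s hr).2 hle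

variable (F) in
lemma nonempty_feasible (hγ : ∀ ℓ, IsPrimitiveRoot (γ ℓ) (n ℓ)) (hk : 0 < k)
    (s : Fin k → Grp n) : (feasible (Fintype.card F) (Fintype.card K) s).Nonempty := by
  have hQ : 0 < Fintype.card K - 1 := Nat.sub_pos_of_lt Fintype.one_lt_card
  refine ⟨fun _ => Fintype.card K - 1, fun _ => le_rfl, ?_, ?_, fun ℓ => ?_⟩
  · simpa using Nat.mul_pos hk hQ
  · exact Nat.modEq_zero_iff_dvd.2 (Finset.dvd_sum fun _ _ => card_sub_one_dvd_card_sub_one F K)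
  · refine Nat.modEq_zero_iff_dvd.2 (Finset.dvd_sum fun i _ => Dvd.dvd.mul_right ?_ _)
    exact (hγ ℓ).dvd_of_pow_eq_one _
      (FiniteField.pow_card_sub_one_eq_one _ ((hγ ℓ).ne_zero (NeZero.ne _)))

theorem exists_isPadicValuation_and_isLeast (hF : Fintype.card F = p ^ e)
    (hγ : ∀ ℓ, IsPrimitiveRoot (γ ℓ) (n ℓ)) {s : Fin k → Grp n}
    {C : Set (AddMonoidAlgebra F (Grp n))} (hC : IsTraceCodeOf C (expMatrix γ s))
    (h0 : ∃ c ∈ C, c ≠ 0) :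
    ∃ t : ℕ, IsPadicValuation p C t ∧
      IsLeast (objective p e '' feasible (Fintype.card F) (Fintype.card K) s) (t : ℚ) := by
  let X : Set ℕ := {x | (x : ℚ) ∈ objective p e '' feasible (Fintype.card F) (Fintype.card K) s}
  have hnat (r) (hr : r ∈ feasible (Fintype.card F) (Fintype.card K) s) :
      ∃ x ∈ X, objective p e r = x := by
    obtain ⟨x, hx⟩ := exists_sum_digitSum_eq_mul_add hr.2.1
      (hF ▸ Nat.modEq_zero_iff_dvd.1 hr.2.2.1)
    exact ⟨x, ⟨r, hr, objective_eq hx⟩, objective_eq hx⟩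
  have hmem : sInf X ∈ X := by
    obtain ⟨r, hr⟩ := nonempty_feasible F hγ (pos_of_isTraceCodeOf hC h0) s
    obtain ⟨x, hx, -⟩ := hnat r hr
    exact Nat.sInf_mem ⟨x, hx⟩
  have hle (r) (hr : r ∈ feasible (Fintype.card F) (Fintype.card K) s) :
      ((sInf X : ℕ) : ℚ) ≤ objective p e r := by
    obtain ⟨x, hx, hrx⟩ := hnat r hr
    exact hrx ▸ Nat.cast_le.2 (Nat.sInf_le hx)
  refine ⟨sInf X, ⟨(isDivisible_pow_iff_forall_le_objective hF hγ hC).2 hle, fun u hu => ?_⟩,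
    hmem, Set.forall_mem_image.2 hle⟩
  obtain ⟨r, hr, hrx⟩ := hmem
  exact Nat.cast_le.1 (hrx ▸ (isDivisible_pow_iff_forall_le_objective hF hγ hC).1 hu r hr)

end Weight

lemma orderOf_natCast_pos {N q : ℕ} (hN : N ≠ 0) (hq : q.Coprime N) :
    0 < orderOf (q : ZMod N) := by
  have : NeZero N := ⟨hN⟩
  rw [← ZMod.coe_unitOfCoprime q hq, orderOf_units]
  exact orderOf_pos _

end AbelianCode

theorem mainTheorem4_general {F K : Type*} [Field F] [Field K] [Finite K] [Algebra F K]
    (p e : ℕ) (hp : p.Prime) (hF : Nat.card F = p ^ e)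
    {h : ℕ} (n : Fin h → ℕ) (hn : ∀ ℓ, 0 < n ℓ)
    (γ : Fin h → K) (hγ : ∀ ℓ, IsPrimitiveRoot (γ ℓ) (n ℓ))
    (C : Ideal (AddMonoidAlgebra F (AbelianCode.Grp n))) :
    (∃ (k : ℕ) (s : Fin k → AbelianCode.Grp n), Function.Injective s ∧
      AbelianCode.IsTraceCodeOf (C : Set (AddMonoidAlgebra F (AbelianCode.Grp n)))
        (AbelianCode.expMatrix γ s)) ∧
    ∀ (k : ℕ) (s : Fin k → AbelianCode.Grp n),
      AbelianCode.IsTraceCodeOf (C : Set (AddMonoidAlgebra F (AbelianCode.Grp n)))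
        (AbelianCode.expMatrix γ s) →
      C ≠ ⊥ →
      ∃ t : ℕ,
        AbelianCode.IsPadicValuation p
          (C : Set (AddMonoidAlgebra F (AbelianCode.Grp n))) t ∧
        IsLeast (AbelianCode.objective p e ''
          AbelianCode.feasible (Nat.card F) (Nat.card K) s) (t : ℚ) := by
  have : Fact p.Prime := ⟨hp⟩
  have (ℓ : Fin h) : NeZero (n ℓ) := ⟨(hn ℓ).ne'⟩
  have : Finite F := Finite.of_injective _ (algebraMap F K).injective
  have := Fintype.ofFinite F
  have := Fintype.ofFinite K
  rw [Nat.card_eq_fintype_card] at hF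
  have : CharP F p := charP_of_card_eq_prime_pow hF
  have : CharP K p := charP_of_injective_algebraMap (algebraMap F K).injective p
  refine ⟨AbelianCode.exists_isTraceCodeOf hγ C, fun k s hC hC0 => ?_⟩
  simp only [Nat.card_eq_fintype_card]
  exact AbelianCode.exists_isPadicValuation_and_isLeast hF hγ hC (C.ne_bot_iff.1 hC0)

theorem mainTheorem4 {F K : Type*} [Field F] [Finite F] [Field K] [Algebra F K]
    (p e q : ℕ) (hp : p.Prime) (hq : q = p ^ e) (hF : Nat.card F = q)
    {h : ℕ} (n : Fin h → ℕ) (hn : ∀ ℓ, 0 < n ℓ)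
    (N : ℕ) (hN : N = AddMonoid.exponent (AbelianCode.Grp n)) (hNq : Nat.Coprime N q)
    (m : ℕ) (hm : m = orderOf (q : ZMod N)) (hK : Module.finrank F K = m)
    (γ : Fin h → K) (hγ : ∀ ℓ, IsPrimitiveRoot (γ ℓ) (n ℓ))
    (C : Ideal (AddMonoidAlgebra F (AbelianCode.Grp n))) :
    (∃ (k : ℕ) (s : Fin k → AbelianCode.Grp n), Function.Injective s ∧
      AbelianCode.IsTraceCodeOf (C : Set (AddMonoidAlgebra F (AbelianCode.Grp n)))
        (AbelianCode.expMatrix γ s)) ∧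
    ∀ (k : ℕ) (s : Fin k → AbelianCode.Grp n),
      AbelianCode.IsTraceCodeOf (C : Set (AddMonoidAlgebra F (AbelianCode.Grp n)))
        (AbelianCode.expMatrix γ s) →
      C ≠ ⊥ →
      ∃ t : ℕ,
        AbelianCode.IsPadicValuation p
          (C : Set (AddMonoidAlgebra F (AbelianCode.Grp n))) t ∧
        IsLeast (AbelianCode.objective p e '' AbelianCode.feasible q (q ^ m) s) (t : ℚ) := by
  have (ℓ : Fin h) : NeZero (n ℓ) := ⟨(hn ℓ).ne'⟩
  have hm0 : 0 < m := hm ▸ AbelianCode.orderOf_natCast_pos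
    (hN ▸ AddMonoid.exponent_ne_zero_of_finite) hNq.symm
  have : FiniteDimensional F K := Module.finite_of_finrank_pos (hK ▸ hm0)
  have : Finite K := Module.finite_of_finite F
  have hcard : Nat.card K = q ^ m := by
    rw [Module.natCard_eq_pow_finrank (K := F), hF, hK]
  rw [← hcard, ← hF]
  exact mainTheorem4_general p e hp (hF.trans hq) n hn γ hγ C
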